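/- **Semi-coarse spaces.** A semi-coarse structure on a set $X$ is a family $\mathcal V$ of subsets of $X\times X$ (the controlled sets) that contains the diagonal and is closed under subsets, finite unions and inverses. A map is bornologous if it sends controlled sets to controlled sets. A subset $A\subset X$ carries $\mathcal V_A=\{V\cap(A\times A): V\in\mathcal V\}$; the product $X\times Y$ has as controlled sets the subsets of the sets $\{((x,y),(x',y')):(x,x')\in V,(y,y')\in W\}$ with $V,W$ controlled; $\mathbb Z_1$ is $\mathbb Z$ with controlled sets the subsets of $\{(i,j):|i-j|\le 1\}$. Bornologous maps $f,g:X\to Y$ are homotopic, $f\simeq_{sc}g$, if there are a bornologous $H:X\times\mathbb Z_1\to Y$ and $M,N\in\mathbb Z$ with $H(\cdot,k)=f$ for $k\le M$ and $H(\cdot,k)=g$ for $k\ge N$. A space is connected if any two points are joined by a bornologous path $\{0,\dots,n\}\to X$, where $\{0,\dots,n\}\subset\mathbb Z_1$. **Well-splitting.** Let $A,B\subset X$ be non-empty with $A\cup B=X$, and let $\mathcal V_{\sqcup}$ be the structure on $X$ obtained from the disjoint union of the subspaces $A$ and $B$ by identifying the two copies of $A\cap B$. Then $A,B$ well-split $X$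 if for all $x,y,y'\in X$ with $\{(x,y),(x,y')\}\in\mathcal V\setminus\mathcal V_\sqcup$ and $\{(y,y')\}\in\mathcal V_\sqcup$: (1) there are bornologous paths $\gamma,\gamma':\{0,1,2\}\to(X,\mathcal V_\sqcup)$ with $\gamma(0)=\gamma'(0)=x$, $\gamma(2)=y$, $\gamma'(2)=y'$, $\gamma(1)=\gamma'(1)$; (2) the set of all $\gamma(1)$, where $\gamma:\{0,1,2\}\to(X,\mathcal V_\sqcup)$ is a bornologous path from $x$ to $y$, is connected as a subspace of $(X,\mathcal V)$. **The relative fundamental groupoid.** Let $\mathcal U\subset 2^X$. Consider bornologous maps $f:\mathbb Z_1\to X$ whose tails are controlled by $\mathcal U$: for some $U_1,U_2\in\mathcal U$, $f(z)\in U_1$ for all sufficiently small $z$ and $f(z)\in U_2$ for all sufficiently large $z$. Such an $f$ is symmetric if $f(-z)=f(z)$; symmetric maps $f,g$ are eventually equal if $f(N+k)=g(M+k)$ for some $N,M\in\mathbb N_0$ and all $k\in\mathbb N_0$. The objects of $\pi_{\le1}(X,\mathcal U)$ are the classes $\langle f\rangle_\infty$ of symmetric maps under the equivalence relation generated by "eventually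 equal or homotopic". A string from $\langle f_0\rangle_\infty$ to $\langle f_{n+1}\rangle_\infty$ is a sequence $(f_1,\dots,f_n)$, $n\ge1$, of such maps such that for every $0\le i\le n$ there are $N_i,M_i\in\mathbb Z$ for which the maps $z\mapsto f_i(z+N_i)$ and $z\mapsto f_{i+1}(-z+M_i)$ on $[0,\infty)\subset\mathbb Z_1$ are homotopic. Morphisms are strings modulo the equivalence relation generated by the following moves. * Deleting consecutive $f_i,f_{i+1}$ from a string with $n\ge3$, if $f_i(z)=f_{i+1}(-(z+N))$ for some $N\in\mathbb Z$ and all $z$. * Merging: if $f_i(z)=x_0$ for $z\ge N$ and $f_{i+1}(z)=x_0$ for $z\le M$, and $N\le j\le M$, replacing $f_i,f_{i+1}$ by the single map $g$ with $g=f_i$ on $(-\infty,j]$ and $g=f_{i+1}$ on $(j,\infty)$. * Replacing components $f_i$ by maps obtained from them by deleting or adding points; deleting $z_0$ from $f$ gives $g(z)=f(z)$ for $z<z_0$ and $g(z)=f(z+1)$ for $z\ge z_0$, provided $g$ is bornologous, and adding is the inverse operation. Merging to $g$ at $j$, and passing between $f$ and $g$ by deletion or addition at $j=z_0$, are allowed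 only under a no-cycles condition: if $g$ is periodic on $[j-1,\infty)$ and on $[j-k,\infty)$ for some $k>1$, then $g|_{[j,\infty)}$ is homotopic to a constant, and symmetrically on the left. (This holds automatically if $g$ is constant near $\pm\infty$, in particular for all maps occurring when $\mathcal U$ consists of singletons.) Composition is concatenation of strings, and $\pi_{\le1}(X,\mathcal U)$ is a groupoid. For $A\subset X$ put $\mathcal U\cap A=\{U\cap A:U\in\mathcal U\}$; inclusions induce functors by composition. **Theorem.** Let $X$ be a semi-coarse space and $\mathcal U=\{\{x\}:x\in X\}$. For all $A,B\subset X$ that well-split $X$, the square $$\begin{array}{ccc}\pi_{\le1}(A\cap B,\mathcal U\cap A\cap B)&\to&\pi_{\le1}(A,\mathcal U\cap A)\\ \downarrow&&\downarrow\\ \pi_{\le1}(B,\mathcal U\cap B)&\to&\pi_{\le1}(X,\mathcal U)\end{array}$$ induced by the inclusions is a pushout in the category of groupoids. Moreover, $\pi_{\le1}(X,\mathcal U)$ contains every semi-coarse fundamental group $\pi_1^{sc}(X,x)$, $x\in X$: sending the class of a loop $f:\{0,\dots,n\}\to X$ at $x$ to the class of the one-term string consisting of $f$ prolonged by the constant $x$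 is a well-defined injective homomorphism from $\pi_1^{sc}(X,x)$ to the automorphism group of $\langle\hat x\rangle_\infty$, where $\hat x$ is the constant map at $x$ (products of loops going to composites written in the order of the paths). Here $\pi_1^{sc}(X,x)$ is the direct limit over $n$ (extending loops by the constant $x$) of the sets of homotopy classes, as maps of pairs $(\{0,\dots,n\},\{0,n\})\to(X,\{x\})$, of bornologous loops $f:\{0,\dots,n\}\to X$ with $f(0)=f(n)=x$, with the product induced by concatenation. -/

import Mathlib

open CategoryTheory

universe u v

/-- A semi-coarse structure on `X`: a family of controlled subsets of `X × X`. -/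
structure SemiCoarse (X : Type u) where
  /-- the controlled sets -/
  controlled : Set (Set (X × X))
  diag_mem : Set.diagonal X ∈ controlled
  subset_mem : ∀ {S T : Set (X × X)}, T ∈ controlled → S ⊆ T → S ∈ controlled
  union_mem : ∀ {S T : Set (X × X)}, S ∈ controlled → T ∈ controlled → S ∪ T ∈ controlled
  inv_mem : ∀ {S : Set (X × X)}, S ∈ controlled → Prod.swap '' S ∈ controlled

namespace SemiCoarse

variable {X Y Z : Type*}

/-- `f` is bornologous if `f × f` maps controlled sets to controlled sets. -/
def Bornologous (V : SemiCoarse X) (W : SemiCoarse Y) (f : X → Y) : Prop :=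
  ∀ S ∈ V.controlled, Prod.map f f '' S ∈ W.controlled

/-- The subspace structure: the sets `S ∩ (A × A)`, `S` controlled in `X`; that is, the subsets of
`A × A` which are controlled in `X`. -/
def sub (V : SemiCoarse X) (A : Set X) : SemiCoarse A where
  controlled := {S | Prod.map Subtype.val Subtype.val '' S ∈ V.controlled}
  diag_mem := V.subset_mem V.diag_mem (by rintro _ ⟨⟨a, b⟩, h, rfl⟩; cases h; rfl)
  subset_mem := fun hT h => V.subset_mem hT (Set.image_mono h)
  union_mem := fun hS hT => by
    simp only [Set.mem_ofPred_eq, Set.image_union] at *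
    exact V.union_mem hS hT
  inv_mem := fun hS => V.subset_mem (V.inv_mem hS) (by
    rintro _ ⟨_, ⟨⟨a, b⟩, h, rfl⟩, rfl⟩
    exact ⟨_, ⟨_, h, rfl⟩, rfl⟩)

/-- The (categorical) product structure: subsets of the sets `S ⊠ T`. -/
def prod (V : SemiCoarse X) (W : SemiCoarse Y) : SemiCoarse (X × Y) where
  controlled := {U | ∃ S ∈ V.controlled, ∃ T ∈ W.controlled,
    U ⊆ {p | (p.1.1, p.2.1) ∈ S ∧ (p.1.2, p.2.2) ∈ T}}
  diag_mem := ⟨_, V.diag_mem, _, W.diag_mem, by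
    rintro ⟨a, b⟩ h; cases h; exact ⟨rfl, rfl⟩⟩
  subset_mem := fun ⟨S, hS, T, hT, h⟩ h' => ⟨S, hS, T, hT, h'.trans h⟩
  union_mem := fun ⟨S, hS, T, hT, h⟩ ⟨S', hS', T', hT', h'⟩ =>
    ⟨S ∪ S', V.union_mem hS hS', T ∪ T', W.union_mem hT hT', by
      rintro p (hp | hp)
      · exact ⟨Or.inl (h hp).1, Or.inl (h hp).2⟩
      · exact ⟨Or.inr (h' hp).1, Or.inr (h' hp).2⟩⟩
  inv_mem := fun ⟨S, hS, T, hT, h⟩ => ⟨_, V.inv_mem hS, _, W.inv_mem hT, by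
    rintro _ ⟨p, hp, rfl⟩
    exact ⟨⟨_, (h hp).1, rfl⟩, ⟨_, (h hp).2, rfl⟩⟩⟩

/-- The disjoint union of two semi-coarse spaces: the sets `S ⊔ T`, `S` and `T` controlled. -/
def disjointUnion (V : SemiCoarse X) (W : SemiCoarse Y) : SemiCoarse (X ⊕ Y) where
  controlled := {U | ∃ S ∈ V.controlled, ∃ T ∈ W.controlled,
    U = Prod.map Sum.inl Sum.inl '' S ∪ Prod.map Sum.inr Sum.inr '' T}
  diag_mem := ⟨_, V.diag_mem, _, W.diag_mem, by
    ext ⟨a | a, b | b⟩ <;> simp [Prod.ext_iff]⟩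
  subset_mem := by
    rintro U _ ⟨S, hS, T, hT, rfl⟩ h
    refine ⟨{p | Prod.map Sum.inl Sum.inl p ∈ U}, V.subset_mem hS ?_,
      {p | Prod.map Sum.inr Sum.inr p ∈ U}, W.subset_mem hT ?_, ?_⟩
    · intro p hp
      rcases h hp with ⟨q, hq, e⟩ | ⟨q, hq, e⟩
      · obtain rfl : q = p := by simpa [Prod.ext_iff] using e
        exact hq
      · simp [Prod.ext_iff] at e
    · intro p hp
      rcases h hp with ⟨q, hq, e⟩ | ⟨q, hq, e⟩
      · simp [Prod.ext_iff] at e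
      · obtain rfl : q = p := by simpa [Prod.ext_iff] using e
        exact hq
    · apply Set.Subset.antisymm
      · intro p hp
        rcases h hp with ⟨q, hq, rfl⟩ | ⟨q, hq, rfl⟩
        · exact Or.inl ⟨q, hp, rfl⟩
        · exact Or.inr ⟨q, hp, rfl⟩
      · rintro p (⟨q, hq, rfl⟩ | ⟨q, hq, rfl⟩)
        · exact hq
        · exact hq
  union_mem := by
    rintro _ _ ⟨S, hS, T, hT, rfl⟩ ⟨S', hS', T', hT', rfl⟩
    refine ⟨S ∪ S', V.union_mem hS hS', T ∪ T', W.union_mem hT hT', ?_⟩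
    simp only [Set.image_union]
    exact Set.union_union_union_comm _ _ _ _
  inv_mem := by
    rintro _ ⟨S, hS, T, hT, rfl⟩
    refine ⟨_, V.inv_mem hS, _, W.inv_mem hT, ?_⟩
    simp only [Set.image_union, Set.image_image]
    rfl

/-- The quotient structure induced by a surjection `g`: the images of the controlled sets. -/
def quotient (V : SemiCoarse X) (g : X → Y) (hg : Function.Surjective g) : SemiCoarse Y where
  controlled := {U | ∃ S ∈ V.controlled, U = Prod.map g g '' S}
  diag_mem := ⟨_, V.diag_mem, by
    apply Set.Subset.antisymm
    · rintro ⟨a, b⟩ h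
      cases h
      obtain ⟨x, rfl⟩ := hg a
      exact ⟨(x, x), rfl, rfl⟩
    · rintro _ ⟨⟨a, b⟩, h, rfl⟩
      cases h
      rfl⟩
  subset_mem := by
    rintro U _ ⟨S, hS, rfl⟩ h
    refine ⟨{p ∈ S | Prod.map g g p ∈ U}, V.subset_mem hS (fun p hp => hp.1), ?_⟩
    apply Set.Subset.antisymm
    · intro p hp
      obtain ⟨q, hq, rfl⟩ := h hp
      exact ⟨q, ⟨hq, hp⟩, rfl⟩
    · rintro _ ⟨q, hq, rfl⟩
      exact hq.2
  union_mem := by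
    rintro _ _ ⟨S, hS, rfl⟩ ⟨T, hT, rfl⟩
    exact ⟨_, V.union_mem hS hT, (Set.image_union _ _ _).symm⟩
  inv_mem := by
    rintro _ ⟨S, hS, rfl⟩
    refine ⟨_, V.inv_mem hS, ?_⟩
    simp only [Set.image_image]
    rfl

/-- When `A ∪ B = X`, the pushout `A ⊔_{A ∩ B} B`, i.e. the quotient of the disjoint union of the
subspaces `A` and `B` which identifies the two copies of every point of `A ∩ B`. Its underlying
set is identified with `X`, the quotient map being given by the two inclusions. -/
def gluing (V : SemiCoarse X) (A B : Set X) (h : A ∪ B = Set.univ) : SemiCoarse X :=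
  (disjointUnion (V.sub A) (V.sub B)).quotient (Sum.elim Subtype.val Subtype.val) (by
    intro x
    rcases (h ▸ Set.mem_univ x : x ∈ A ∪ B) with hx | hx
    · exact ⟨Sum.inl ⟨x, hx⟩, rfl⟩
    · exact ⟨Sum.inr ⟨x, hx⟩, rfl⟩)

/-- The space `ℤ₁`: a set is controlled iff all its pairs `(i, j)` satisfy `|i - j| ≤ 1`. -/
def Z1 : SemiCoarse ℤ where
  controlled := {S | ∀ p ∈ S, |p.1 - p.2| ≤ 1}
  diag_mem := by rintro ⟨a, b⟩ h; cases h; simp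
  subset_mem := fun hT h p hp => hT p (h hp)
  union_mem := fun hS hT p hp => hp.elim (hS p) (hT p)
  inv_mem := by
    rintro S hS _ ⟨p, hp, rfl⟩
    have := hS p hp
    rwa [abs_sub_comm] at this

/-- `f` and `g` are homotopic. -/
def Homotopic (V : SemiCoarse X) (W : SemiCoarse Y) (f g : X → Y) : Prop :=
  ∃ H : X × ℤ → Y, Bornologous (V.prod Z1) W H ∧ ∃ M N : ℤ,
    (∀ x, ∀ k ≤ M, H (x, k) = f x) ∧ (∀ x, ∀ k ≥ N, H (x, k) = g x)

/-- Path-connectedness: any two points are joined by a path `{0, …, n} → X`. -/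
def Connected (V : SemiCoarse X) : Prop :=
  ∀ x y : X, ∃ (n : ℕ) (γ : Set.Icc (0 : ℤ) n → X), Bornologous (Z1.sub _) V γ ∧
    γ ⟨0, by simp⟩ = x ∧ γ ⟨n, by simp⟩ = y

/-- `γ : {0, 1, 2} → X` is a bornologous path from `x` to `y` with middle point `w`. -/
def IsShortPath (V : SemiCoarse X) (γ : Set.Icc (0 : ℤ) 2 → X) (x w y : X) : Prop :=
  Bornologous (Z1.sub _) V γ ∧
    γ ⟨0, by simp⟩ = x ∧ γ ⟨1, by simp⟩ = w ∧ γ ⟨2, by simp⟩ = y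

/-- The subsets `A`, `B` well-split `X`. -/
structure WellSplit (V : SemiCoarse X) (A B : Set X) : Prop where
  nonempty_left : A.Nonempty
  nonempty_right : B.Nonempty
  cover : A ∪ B = Set.univ
  common_midpoint : ∀ x y y' : X,
    {(x, y), (x, y')} ∈ V.controlled \ (V.gluing A B cover).controlled →
    {(y, y')} ∈ (V.gluing A B cover).controlled →
    ∃ γ γ' w, IsShortPath (V.gluing A B cover) γ x w y ∧
      IsShortPath (V.gluing A B cover) γ' x w y'
  midpoints_connected : ∀ x y y' : X,
    {(x, y), (x, y')} ∈ V.controlled \ (V.gluing A B cover).controlled →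
    {(y, y')} ∈ (V.gluing A B cover).controlled →
    (V.sub {w | ∃ γ, IsShortPath (V.gluing A B cover) γ x w y}).Connected

/-! ### Basic facts on bornologous maps and homotopies -/

theorem Bornologous.comp {V : SemiCoarse X} {W : SemiCoarse Y} {U : SemiCoarse Z}
    {g : Y → Z} {f : X → Y} (hg : Bornologous W U g) (hf : Bornologous V W f) :
    Bornologous V U (fun x => g (f x)) := by
  intro S hS
  have := hg _ (hf S hS)
  rwa [Set.image_image] at this

theorem Bornologous.const (V : SemiCoarse X) (W : SemiCoarse Y) (y : Y) :
    Bornologous V W (fun _ => y) := by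
  intro S _
  refine W.subset_mem W.diag_mem ?_
  rintro _ ⟨p, _, rfl⟩
  rfl

theorem Bornologous.fst (V : SemiCoarse X) (W : SemiCoarse Y) :
    Bornologous (V.prod W) V Prod.fst := by
  rintro U ⟨S, hS, T, hT, h⟩
  refine V.subset_mem hS ?_
  rintro _ ⟨p, hp, rfl⟩
  exact (h hp).1

theorem Bornologous.prodMap {X' Y' : Type*} {V : SemiCoarse X} {W : SemiCoarse Y}
    {V' : SemiCoarse X'} {W' : SemiCoarse Y'} {f : X → X'} {g : Y → Y'}
    (hf : Bornologous V V' f) (hg : Bornologous W W' g) :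
    Bornologous (V.prod W) (V'.prod W') (Prod.map f g) := by
  rintro U ⟨S, hS, T, hT, h⟩
  refine ⟨_, hf S hS, _, hg T hT, ?_⟩
  rintro _ ⟨p, hp, rfl⟩
  exact ⟨⟨_, (h hp).1, rfl⟩, ⟨_, (h hp).2, rfl⟩⟩

theorem Bornologous.id (V : SemiCoarse X) : Bornologous V V (fun x => x) := by
  intro S hS
  refine V.subset_mem hS ?_
  rintro _ ⟨p, hp, rfl⟩
  exact hp

/-- Gluing of bornologous maps along two subsets which carry all controlled sets. -/
theorem Bornologous.glue {V : SemiCoarse X} {W : SemiCoarse Y} {K K₁ K₂ : X → Y} (S T : Set X)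
    (h₁ : Bornologous V W K₁) (h₂ : Bornologous V W K₂)
    (e₁ : ∀ x ∈ S, K x = K₁ x) (e₂ : ∀ x ∈ T, K x = K₂ x)
    (h : ∀ U ∈ V.controlled, ∀ p ∈ U, (p.1 ∈ S ∧ p.2 ∈ S) ∨ (p.1 ∈ T ∧ p.2 ∈ T)) :
    Bornologous V W K := by
  intro U hU
  refine W.subset_mem (W.union_mem (h₁ U hU) (h₂ U hU)) ?_
  rintro _ ⟨p, hp, rfl⟩
  rcases h U hU p hp with ⟨a, b⟩ | ⟨a, b⟩
  · exact Or.inl ⟨p, hp, by simp [Prod.map, e₁ _ a, e₁ _ b]⟩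
  · exact Or.inr ⟨p, hp, by simp [Prod.map, e₂ _ a, e₂ _ b]⟩

theorem bornologous_Z1 {f : ℤ → ℤ} (h : ∀ a b, |a - b| ≤ 1 → |f a - f b| ≤ 1) :
    Bornologous Z1 Z1 f := by
  rintro S hS _ ⟨p, hp, rfl⟩
  exact h _ _ (hS p hp)

theorem bornologous_Z1_prod {f : ℤ × ℤ → ℤ}
    (h : ∀ a b c d, |a - b| ≤ 1 → |c - d| ≤ 1 → |f (a, c) - f (b, d)| ≤ 1) :
    Bornologous (Z1.prod Z1) Z1 f := by
  rintro U ⟨S, hS, T, hT, hU⟩ _ ⟨p, hp, rfl⟩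
  exact h _ _ _ _ (hS _ (hU hp).1) (hT _ (hU hp).2)

theorem bornologous_neg {V : SemiCoarse X} {f : ℤ → X} (hf : Bornologous Z1 V f) :
    Bornologous Z1 V (fun z => f (-z)) :=
  hf.comp (bornologous_Z1 (f := fun z => -z) (by intro a b h; rw [abs_le] at *; omega))

theorem bornologous_val (V : SemiCoarse X) (A : Set X) :
    Bornologous (V.sub A) V Subtype.val := fun _ hS => hS

theorem bornologous_inclusion (V : SemiCoarse X) {A B : Set X} (h : A ⊆ B) :
    Bornologous (V.sub A) (V.sub B) (Set.inclusion h) := by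
  intro S hS
  refine V.subset_mem hS ?_
  rintro _ ⟨_, ⟨p, hp, rfl⟩, rfl⟩
  exact ⟨p, hp, rfl⟩

theorem Homotopic.refl {V : SemiCoarse X} {W : SemiCoarse Y} {f : X → Y}
    (hf : Bornologous V W f) : Homotopic V W f f :=
  ⟨fun p => f p.1, hf.comp (Bornologous.fst V Z1), 0, 0, fun _ _ _ => rfl, fun _ _ _ => rfl⟩

theorem Homotopic.symm {V : SemiCoarse X} {W : SemiCoarse Y} {f g : X → Y}
    (h : Homotopic V W f g) : Homotopic V W g f := by
  obtain ⟨H, hH, M, N, hM, hN⟩ := h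
  refine ⟨fun p => H (Prod.map (fun x => x) (fun z => -z) p), hH.comp
    ((Bornologous.id V).prodMap (bornologous_Z1 (by intro a b h; rw [abs_le] at *; omega))),
    -N, -M, ?_, ?_⟩
  · intro x k hk
    exact hN x (-k) (by omega)
  · intro x k hk
    exact hM x (-k) (by omega)

theorem Homotopic.trans {V : SemiCoarse X} {W : SemiCoarse Y} {f g k : X → Y}
    (h : Homotopic V W f g) (h' : Homotopic V W g k) : Homotopic V W f k := by
  obtain ⟨H, hH, M, N, hM, hN⟩ := h
  obtain ⟨H', hH', M', N', hM', hN'⟩ := h'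
  have hB : Bornologous (V.prod Z1) W
      (fun p => H' (Prod.map (fun x => x) (fun z => z - N + M') p)) :=
    hH'.comp ((Bornologous.id V).prodMap (bornologous_Z1 (f := fun z => z - N + M')
      (by intro a b h; rw [abs_le] at *; omega)))
  refine ⟨fun p => if p.2 ≤ N then H p else H' (Prod.map (fun x => x) (fun z => z - N + M') p),
    Bornologous.glue {p | p.2 ≤ N} {p | N ≤ p.2} hH hB
    ?_ ?_ ?_, min M N, max (N + 1) (N' + N - M'), ?_, ?_⟩
  · intro p hp
    exact if_pos hp
  · rintro ⟨x, t⟩ ht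
    simp only [Set.mem_ofPred_eq] at ht
    simp only [Prod.map]
    split_ifs with h
    · rw [hN x t ht, hM' x _ (by omega)]
    · rfl
  · rintro U ⟨S, hS, T, hT, h⟩ p hp
    have := hT _ (h hp).2
    simp only [abs_le, Set.mem_ofPred_eq] at *
    omega
  · intro x t ht
    simp only
    rw [if_pos (by omega), hM x t (by omega)]
  · intro x t ht
    simp only [Prod.map]
    rw [if_neg (by omega), hN' x _ (by omega)]

theorem Homotopic.precomp {V : SemiCoarse X} {W : SemiCoarse Y} {U : SemiCoarse Z} {f g : Y → Z}
    (h : Homotopic W U f g) {r : X → Y} (hr : Bornologous V W r) :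
    Homotopic V U (fun x => f (r x)) (fun x => g (r x)) := by
  obtain ⟨H, hH, M, N, hM, hN⟩ := h
  exact ⟨fun p => H (Prod.map r (fun z => z) p), hH.comp (hr.prodMap (Bornologous.id Z1)), M, N,
    fun x k hk => hM _ _ hk, fun x k hk => hN _ _ hk⟩

theorem Homotopic.postcomp {V : SemiCoarse X} {W : SemiCoarse Y} {U : SemiCoarse Z} {f g : X → Y}
    (h : Homotopic V W f g) {r : Y → Z} (hr : Bornologous W U r) :
    Homotopic V U (fun x => r (f x)) (fun x => r (g x)) := by
  obtain ⟨H, hH, M, N, hM, hN⟩ := h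
  exact ⟨fun p => r (H p), hr.comp hH, M, N,
    fun x k hk => congrArg r (hM _ _ hk), fun x k hk => congrArg r (hN _ _ hk)⟩

/-! ### The semi-coarse fundamental group -/

/-- A based loop `f : {0, …, len} → X` with `f 0 = f len = x`, prolonged by the constant `x` to all
of `ℤ`. In this form the stabilisation maps `f ↦ f_m` of the directed system that defines the
fundamental group leave the function unchanged and only increase `len`. -/
structure Loop (V : SemiCoarse X) (x : X) where
  /-- the loop, prolonged by constants -/
  toFun : ℤ → X
  /-- the length of the loop -/
  len : ℕ
  born : Bornologous Z1 V toFun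
  left : ∀ z : ℤ, z ≤ 0 → toFun z = x
  right : ∀ z : ℤ, (len : ℤ) ≤ z → toFun z = x

/-- Two loops become homotopic, as maps of pairs `({0, …, m}, {0, m}) → (X, {x})`, for some `m`. -/
def Loop.Homotopic {V : SemiCoarse X} {x : X} (f g : Loop V x) : Prop :=
  ∃ (m : ℕ) (H : ℤ × ℤ → X), Bornologous (Z1.prod Z1) V H ∧
    (∀ k t : ℤ, k ≤ 0 ∨ (m : ℤ) ≤ k → H (k, t) = x) ∧ ∃ M N : ℤ,
      (∀ k : ℤ, ∀ t ≤ M, H (k, t) = f.toFun k) ∧ (∀ k : ℤ, ∀ t ≥ N, H (k, t) = g.toFun k)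

/-- The semi-coarse fundamental group `π₁^sc(X, x)`: the direct limit over `m` of the homotopy
classes of loops of length `m`. -/
def FundGroup (V : SemiCoarse X) (x : X) : Type _ := Quot (Loop.Homotopic (V := V) (x := x))

namespace Loop

variable {V : SemiCoarse X} {x : X}

/-- Run through `f` up to time `N ≥ len`, then through `g`. -/
def concatAt (f g : Loop V x) (N : ℕ) (hN : f.len ≤ N) : Loop V x where
  toFun j := if j ≤ N then f.toFun j else g.toFun (j - N)
  len := N + g.len
  born := by
    refine Bornologous.glue {j | j ≤ (N : ℤ)} {j | (N : ℤ) ≤ j} f.born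
      (g.born.comp (bornologous_Z1 (f := fun j => j - N)
        (by intro a b h; rw [abs_le] at *; omega))) ?_ ?_ ?_
    · intro j hj
      exact if_pos hj
    · intro j hj
      simp only [Set.mem_ofPred_eq] at hj
      split_ifs with h
      · rw [f.right _ (by omega), g.left _ (by omega)]
      · rfl
    · intro U hU p hp
      have := hU p hp
      simp only [abs_le, Set.mem_ofPred_eq] at *
      omega
  left z hz := by
    rw [if_pos (by omega), f.left z hz]
  right z hz := by
    push_cast at hz
    split_ifs with h
    · exact f.right z (by omega)
    · exact g.right _ (by omega)

/-- The product `f ⋆ g` of loops. -/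
def star (f g : Loop V x) : Loop V x := f.concatAt g f.len le_rfl

/-- The constant loop. -/
def refl (V : SemiCoarse X) (x : X) : Loop V x where
  toFun _ := x
  len := 0
  born := Bornologous.const _ _ _
  left _ _ := rfl
  right _ _ := rfl

/-- The reversed loop. -/
def rev (f : Loop V x) : Loop V x where
  toFun j := f.toFun (f.len - j)
  len := f.len
  born := f.born.comp (bornologous_Z1 (f := fun j => f.len - j)
    (by intro a b h; rw [abs_le] at *; omega))
  left z hz := f.right _ (by omega)
  right z hz := f.left _ (by omega)

theorem concatAt_succ (f g : Loop V x) (N : ℕ) (hN : f.len ≤ N) :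
    Homotopic (f.concatAt g (N + 1) (by omega)) (f.concatAt g N hN) := by
  refine ⟨N + g.len + 1, fun p => if p.1 ≤ N then f.toFun p.1 else
    g.toFun (if p.1 - N ≤ p.2 then p.1 - N else p.1 - N - 1),
    Bornologous.glue {p | p.1 ≤ (N : ℤ)} {p | (N : ℤ) ≤ p.1} (f.born.comp (Bornologous.fst Z1 Z1))
    (g.born.comp (bornologous_Z1_prod
      (f := fun p => if p.1 - N ≤ p.2 then p.1 - N else p.1 - N - 1) ?_)) ?_ ?_ ?_,
      ?_, 0, g.len + 1, ?_, ?_⟩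
  · intro a b c d h h'
    simp only [abs_le] at *
    split_ifs <;> omega
  · intro p hp
    exact if_pos hp
  · intro p hp
    simp only [Set.mem_ofPred_eq] at hp
    by_cases h : p.1 ≤ N
    · rw [if_pos h, f.right _ (by omega), g.left]
      split_ifs <;> omega
    · rw [if_neg h]
  · rintro U ⟨S, hS, T, hT, h⟩ p hp
    have := hS _ (h hp).1
    simp only [abs_le, Set.mem_ofPred_eq] at *
    omega
  · intro k t hk
    simp only
    push_cast at hk
    rcases hk with hk | hk
    · rw [if_pos (by omega), f.left _ hk]
    · rw [if_neg (by omega), g.right]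
      split_ifs <;> omega
  · intro k t ht
    simp only [concatAt]
    push_cast
    by_cases h : k ≤ N
    · rw [if_pos h, if_pos (by omega)]
    · rw [if_neg h, if_neg (by omega)]
      by_cases h' : k = N + 1
      · rw [if_pos (by omega), g.left _ (by omega), f.right _ (by omega)]
      · rw [if_neg (by omega)]
        congr 1
        omega
  · intro k t ht
    simp only [concatAt]
    by_cases h : k ≤ N
    · rw [if_pos h, if_pos h]
    · rw [if_neg h, if_neg h]
      by_cases h' : k - N ≤ t
      · rw [if_pos h']
      · rw [if_neg h', g.right _ (by omega), g.right _ (by omega)]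

theorem mk_concatAt (f g : Loop V x) (N : ℕ) (hN : f.len ≤ N) :
    (Quot.mk _ (f.concatAt g N hN) : V.FundGroup x) = Quot.mk _ (f.star g) := by
  induction N, hN using Nat.le_induction with
  | base => rfl
  | succ n hn ih => exact (Quot.sound (concatAt_succ f g n hn)).trans ih

theorem mk_star_left {f f' : Loop V x} (h : Homotopic f f') (g : Loop V x) :
    (Quot.mk _ (f.star g) : V.FundGroup x) = Quot.mk _ (f'.star g) := by
  obtain ⟨m, H, hH, hx, M, N, hM, hN⟩ := h
  set n := max m (max f.len f'.len) with hn
  rw [← mk_concatAt f g n (by omega), ← mk_concatAt f' g n (by omega)]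
  apply Quot.sound
  refine ⟨n + g.len, fun p => if p.1 ≤ n then H p else g.toFun (p.1 - n),
    Bornologous.glue {p | p.1 ≤ (n : ℤ)} {p | (n : ℤ) ≤ p.1} hH
      ((g.born.comp (bornologous_Z1 (f := fun j => j - n)
        (by intro a b h; rw [abs_le] at *; omega))).comp (Bornologous.fst Z1 Z1)) ?_ ?_ ?_,
      ?_, M, N, ?_, ?_⟩
  · intro p hp
    exact if_pos hp
  · rintro ⟨k, t⟩ hp
    simp only [Set.mem_ofPred_eq] at hp
    simp only
    by_cases h : k ≤ n
    · rw [if_pos h, hx k t (Or.inr (by omega)), g.left _ (by omega)]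
    · rw [if_neg h]
  · rintro U ⟨S, hS, T, hT, h⟩ p hp
    have := hS _ (h hp).1
    simp only [abs_le, Set.mem_ofPred_eq] at *
    omega
  · intro k t hk
    simp only
    push_cast at hk
    by_cases h : k ≤ n
    · rw [if_pos h, hx k t (by omega)]
    · rw [if_neg h, g.right _ (by omega)]
  · intro k t ht
    simp only [concatAt, hM k t ht]
  · intro k t ht
    simp only [concatAt, hN k t ht]

theorem mk_star_right (f : Loop V x) {g g' : Loop V x} (h : Homotopic g g') :
    (Quot.mk _ (f.star g) : V.FundGroup x) = Quot.mk _ (f.star g') := by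
  obtain ⟨m, H, hH, hx, M, N, hM, hN⟩ := h
  apply Quot.sound
  refine ⟨f.len + m, fun p => if p.1 ≤ f.len then f.toFun p.1 else
      H (Prod.map (fun j => j - f.len) (fun t => t) p),
    Bornologous.glue {p | p.1 ≤ (f.len : ℤ)} {p | (f.len : ℤ) ≤ p.1}
      (f.born.comp (Bornologous.fst Z1 Z1))
      (hH.comp ((bornologous_Z1 (f := fun j => j - f.len)
        (by intro a b h; rw [abs_le] at *; omega)).prodMap (Bornologous.id Z1))) ?_ ?_ ?_,
      ?_, M, N, ?_, ?_⟩
  · intro p hp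
    exact if_pos hp
  · rintro ⟨k, t⟩ hp
    simp only [Set.mem_ofPred_eq] at hp
    simp only [Prod.map]
    by_cases h : k ≤ f.len
    · rw [if_pos h, hx _ t (Or.inl (by omega)), f.right _ (by omega)]
    · rw [if_neg h]
  · rintro U ⟨S, hS, T, hT, h⟩ p hp
    have := hS _ (h hp).1
    simp only [abs_le, Set.mem_ofPred_eq] at *
    omega
  · intro k t hk
    simp only [Prod.map]
    push_cast at hk
    by_cases h : k ≤ f.len
    · rw [if_pos h]
      rcases hk with hk | hk
      · exact f.left _ hk
      · exact f.right _ (by omega)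
    · rw [if_neg h, hx _ t (by omega)]
  · intro k t ht
    simp only [star, concatAt, Prod.map, hM _ t ht]
  · intro k t ht
    simp only [star, concatAt, Prod.map, hN _ t ht]

theorem rev_star (f : Loop V x) : Homotopic (f.rev.star f) (refl V x) := by
  refine ⟨f.len + f.len, fun p => f.toFun (max |p.1 - f.len| p.2),
    f.born.comp (bornologous_Z1_prod (f := fun p => max |p.1 - f.len| p.2) ?_),
    ?_, 0, f.len, ?_, ?_⟩
  · intro a b c d h h'
    simp only [abs_le] at *
    rcases abs_cases (a - (f.len : ℤ)) with ⟨e, _⟩ | ⟨e, _⟩ <;>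
    rcases abs_cases (b - (f.len : ℤ)) with ⟨e', _⟩ | ⟨e', _⟩ <;> rw [e, e'] <;> omega
  · intro k t hk
    push_cast at hk
    refine f.right _ (le_max_of_le_left ?_)
    rw [le_abs]
    omega
  · intro k t ht
    simp only [star, concatAt, rev]
    rw [max_eq_left (ht.trans (abs_nonneg _))]
    by_cases h : k ≤ f.len
    · rw [abs_sub_comm, abs_of_nonneg (by omega)]
      exact (if_pos h).symm
    · rw [abs_of_nonneg (by omega)]
      exact (if_neg h).symm
  · intro k t ht
    exact f.right _ (le_max_of_le_right ht)

end Loop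

namespace FundGroup

variable {V : SemiCoarse X} {x : X}

/-- The class of a loop. -/
def mk (f : Loop V x) : V.FundGroup x := Quot.mk _ f

/-- The product induced by `⋆`. -/
instance : Mul (V.FundGroup x) :=
  ⟨Quot.lift₂ (fun f g => mk (f.star g)) (fun f _ _ h => Loop.mk_star_right f h)
    (fun _ _ g h => Loop.mk_star_left h g)⟩

instance : One (V.FundGroup x) := ⟨mk (Loop.refl V x)⟩

noncomputable instance : Inv (V.FundGroup x) := ⟨fun a => mk (Quot.out a).rev⟩

noncomputable instance : Group (V.FundGroup x) :=
  Group.ofLeftAxioms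
    (by
      rintro ⟨f⟩ ⟨g⟩ ⟨h⟩
      refine congrArg (Quot.mk _) ?_
      simp only [Loop.star, Loop.concatAt, Loop.mk.injEq]
      push_cast
      refine ⟨?_, by omega⟩
      funext j
      by_cases h1 : j ≤ f.len
      · rw [if_pos (by omega), if_pos h1, if_pos h1]
      · by_cases h2 : j - f.len ≤ g.len
        · rw [if_pos (by omega), if_neg h1, if_neg h1, if_pos h2]
        · rw [if_neg (by omega), if_neg h1, if_neg h2]
          congr 1
          omega)
    (by
      rintro ⟨f⟩
      refine congrArg (Quot.mk _) ?_
      cases f with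
      | mk f n born left right =>
        simp only [Loop.star, Loop.concatAt, Loop.refl, Loop.mk.injEq]
        refine ⟨?_, by omega⟩
        funext j
        push_cast
        split_ifs with h
        · rw [left _ h]
        · simp)
    (by
      intro a
      have h : a = mk (Quot.out a) := (Quot.out_eq a).symm
      conv_lhs => rw [h]
      change mk ((Quot.out (mk (Quot.out a))).rev.star (Quot.out a)) = _
      rw [← h]
      exact Quot.sound (Loop.rev_star _))

end FundGroup

/-! ### Strings and the relative fundamental groupoid -/

/-- The tails of `f` are controlled by `𝒰`. -/
def TailsControlled (𝒰 : Set (Set X)) (f : ℤ → X) : Prop :=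
  (∃ U ∈ 𝒰, ∃ m : ℤ, ∀ z ≤ m, f z ∈ U) ∧ (∃ U ∈ 𝒰, ∃ n : ℤ, ∀ z ≥ n, f z ∈ U)

/-- Symmetric bornologous maps `ℤ₁ → X` with tails controlled by `𝒰`. -/
structure SymMap (V : SemiCoarse X) (𝒰 : Set (Set X)) where
  /-- the map -/
  toFun : ℤ → X
  born : Bornologous Z1 V toFun
  symm : ∀ z, toFun (-z) = toFun z
  ctrl : TailsControlled 𝒰 toFun

/-- Symmetric maps which are eventually equal. -/
def EventuallyEqual (f g : ℤ → X) : Prop :=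
  ∃ N M : ℕ, ∀ k : ℕ, f ((N : ℤ) + k) = g ((M : ℤ) + k)

/-- The objects `⟨f⟩_∞` of the `𝒰`-relative fundamental groupoid `π_{≤1}(X, 𝒰)`: classes of
symmetric maps for the equivalence relation generated by eventual equality and homotopy. -/
def RelFundGroupoid (V : SemiCoarse X) (𝒰 : Set (Set X)) : Type _ :=
  Quot (fun f g : SymMap V 𝒰 =>
    EventuallyEqual f.toFun g.toFun ∨ Homotopic Z1 V f.toFun g.toFun)

/-- The class `⟨f⟩_∞`. -/
def RelFundGroupoid.mk {V : SemiCoarse X} {𝒰 : Set (Set X)} (f : SymMap V 𝒰) :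
    RelFundGroupoid V 𝒰 := Quot.mk _ f

/-- The subspace `[a, ∞)` of `ℤ₁`. -/
abbrev ray (a : ℤ) : SemiCoarse (Set.Ici a) := Z1.sub (Set.Ici a)

/-- A right tail of `f`, read from left to right, is homotopic to a left tail of `g`, read from
right to left. -/
def TailMatch (V : SemiCoarse X) (f g : ℤ → X) : Prop :=
  ∃ N M : ℤ, Homotopic (ray 0) V (fun z => f ((z : ℤ) + N)) (fun z => g (-(z : ℤ) + M))

/-- `L = (f₁, …, fₙ)`, `n ≥ 1`, is a string from `a` to `b` with tails controlled by `𝒰`. -/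
def IsString (V : SemiCoarse X) (𝒰 : Set (Set X)) (a b : RelFundGroupoid V 𝒰)
    (L : List (ℤ → X)) : Prop :=
  L ≠ [] ∧ (∀ f ∈ L, Bornologous Z1 V f ∧ TailsControlled 𝒰 f) ∧
    ∃ f₀ f₁ : SymMap V 𝒰, RelFundGroupoid.mk f₀ = a ∧ RelFundGroupoid.mk f₁ = b ∧
      List.IsChain (TailMatch V) (f₀.toFun :: (L ++ [f₁.toFun]))

/-- `f` is periodic on `[a, ∞)`. -/
def PeriodicRight (f : ℤ → X) (a : ℤ) : Prop := ∃ p > 0, ∀ z ≥ a, f (z + p) = f z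

/-- The tails of `g` on both sides of `j` contain no infinite number of cycles: if `g` is periodic
on `[j - 1, ∞)`, and even on `[j - k, ∞)` for some `k > 1`, then `g` is homotopic to a constant on
`[j, ∞)`; and symmetrically on the left. (This is automatic if `g` is constant near `±∞`.) -/
def NoCycles (V : SemiCoarse X) (g : ℤ → X) (j : ℤ) : Prop :=
  (PeriodicRight g (j - 1) → (∃ k > 1, PeriodicRight g (j - k)) →
    ∃ c, Homotopic (ray j) V (fun z => g z) (fun _ => c)) ∧
  (PeriodicRight (fun z => g (-z)) (-(j + 1)) →
    (∃ k > 1, PeriodicRight (fun z => g (-z)) (-(j + k))) →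
    ∃ c, Homotopic (ray (-j)) V (fun z => g (-(z : ℤ))) (fun _ => c))

/-- Merging at `j` two maps with the same constant tail. -/
def MergeAt (V : SemiCoarse X) (f g : ℤ → X) (j : ℤ) (h : ℤ → X) : Prop :=
  (∃ (x₀ : X) (N M : ℤ), (∀ z ≥ N, f z = x₀) ∧ (∀ z ≤ M, g z = x₀) ∧ N ≤ j ∧ j ≤ M) ∧
    (h = fun z => if z ≤ j then f z else g z) ∧ NoCycles V h j

/-- `g` is the result of deleting the point `z₀` in `f`. -/
def DeletePoint (V : SemiCoarse X) (f g : ℤ → X) : Prop :=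
  Bornologous Z1 V f ∧ Bornologous Z1 V g ∧ ∃ z₀ : ℤ,
    (g = fun z => if z < z₀ then f z else f (z + 1)) ∧ NoCycles V g z₀

/-- The relation `≃_d` on maps: finitely many deletions and additions of points. -/
def DeleteEquiv (V : SemiCoarse X) : (ℤ → X) → (ℤ → X) → Prop :=
  Relation.EqvGen (DeletePoint V)

/-- The elementary moves between strings: deletion of two consecutive opposite maps (from a string
of length at least three), merging of constant tails, and componentwise `≃_d`. -/
inductive Move (V : SemiCoarse X) : List (ℤ → X) → List (ℤ → X) → Prop
  | deleteOpposite (p q : List (ℤ → X)) (f g : ℤ → X) (N : ℤ) (h : ∀ z, f z = g (-(z + N)))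
      (hpq : p ++ q ≠ []) : Move V (p ++ f :: g :: q) (p ++ q)
  | merge (p q : List (ℤ → X)) (f g h : ℤ → X) (j : ℤ) (H : MergeAt V f g j h) :
      Move V (p ++ f :: g :: q) (p ++ h :: q)
  | deform (F G : List (ℤ → X)) (H : List.Forall₂ (DeleteEquiv V) F G) : Move V F G

/-- Strings from `a` to `b`. -/
def Str {V : SemiCoarse X} {𝒰 : Set (Set X)} (a b : RelFundGroupoid V 𝒰) : Type _ :=
  {L : List (ℤ → X) // IsString V 𝒰 a b L}

/-- Morphisms from `a` to `b`: strings modulo the equivalence relation `≃` generated by the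
elementary moves. -/
def StrClass {V : SemiCoarse X} {𝒰 : Set (Set X)} (a b : RelFundGroupoid V 𝒰) : Type _ :=
  Quot (fun F G : Str a b => Move V F.1 G.1)

section

variable {V : SemiCoarse X} {𝒰 : Set (Set X)}

/-- Right tails of `f` and `g` are homotopic. -/
def RayEquiv (V : SemiCoarse X) (f g : ℤ → X) : Prop :=
  ∃ N M : ℤ, Homotopic (ray 0) V (fun z => f ((z : ℤ) + N)) (fun z => g ((z : ℤ) + M))

theorem tailMatch_iff {f g : ℤ → X} : TailMatch V f g ↔ RayEquiv V f (fun z => g (-z)) := by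
  constructor
  · rintro ⟨N, M, h⟩
    refine ⟨N, -M, ?_⟩
    simpa [add_comm] using h
  · rintro ⟨N, M, h⟩
    refine ⟨N, -M, ?_⟩
    simpa [add_comm] using h

theorem RayEquiv.symm {f g : ℤ → X} (h : RayEquiv V f g) : RayEquiv V g f := by
  obtain ⟨N, M, h⟩ := h
  exact ⟨M, N, h.symm⟩

theorem homotopic_ray_shift {f g : ℤ → X} {N M : ℤ}
    (h : Homotopic (ray 0) V (fun z => f ((z : ℤ) + N)) (fun z => g ((z : ℤ) + M))) (c : ℕ) :
    Homotopic (ray 0) V (fun z => f ((z : ℤ) + (c + N))) (fun z => g ((z : ℤ) + (c + M))) := by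
  have hr : Bornologous (ray 0) (ray 0)
      (fun z : Set.Ici (0 : ℤ) => (⟨(z : ℤ) + c, by
        have := z.2
        simp only [Set.mem_Ici] at *
        omega⟩ : Set.Ici (0 : ℤ))) := by
    rintro S hS _ ⟨_, ⟨p, hp, rfl⟩, rfl⟩
    have := hS _ ⟨p, hp, rfl⟩
    simpa using this
  have := h.precomp hr
  simpa [add_assoc] using this

theorem RayEquiv.trans {f g k : ℤ → X} (h : RayEquiv V f g) (h' : RayEquiv V g k) :
    RayEquiv V f k := by
  obtain ⟨N, M, h⟩ := h
  obtain ⟨N', M', h'⟩ := h'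
  have h1 := homotopic_ray_shift h (N' - M).toNat
  have h2 := homotopic_ray_shift h' (M - N').toNat
  have e : ((N' - M).toNat : ℤ) + M = (M - N').toNat + N' := by omega
  rw [e] at h1
  exact ⟨_, _, h1.trans h2⟩

theorem bornologous_ray {f : ℤ → X} (hf : Bornologous Z1 V f) (N : ℤ) :
    Bornologous (ray 0) V (fun z : Set.Ici (0 : ℤ) => f ((z : ℤ) + N)) :=
  (hf.comp (bornologous_Z1 (f := fun z => z + N) (by intro a b h; rw [abs_le] at *; omega))).comp
    (bornologous_val Z1 _)

theorem rayEquiv_of_shift {f g : ℤ → X} (hf : Bornologous Z1 V f) (N M : ℤ)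
    (h : ∀ z : ℤ, 0 ≤ z → f (z + N) = g (z + M)) : RayEquiv V f g := by
  refine ⟨N, M, ?_⟩
  have : (fun z : Set.Ici (0 : ℤ) => g ((z : ℤ) + M)) =
      fun z : Set.Ici (0 : ℤ) => f ((z : ℤ) + N) :=
    funext fun z => (h z z.2).symm
  rw [this]
  exact Homotopic.refl (bornologous_ray hf N)

theorem rayEquiv_of_mk_eq {f g : SymMap V 𝒰} (h : RelFundGroupoid.mk f = RelFundGroupoid.mk g) :
    RayEquiv V f.toFun g.toFun := by
  have h' := Quot.eqvGen_exact h
  clear h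
  induction h' with
  | rel f g h =>
    rcases h with ⟨N, M, h⟩ | h
    · refine rayEquiv_of_shift f.born N M fun z hz => ?_
      have := h z.toNat
      rw [Int.toNat_of_nonneg hz] at this
      rwa [add_comm z, add_comm z]
    · refine ⟨0, 0, ?_⟩
      simpa using h.precomp (bornologous_val Z1 (Set.Ici 0))
  | refl f => exact rayEquiv_of_shift f.born 0 0 fun _ _ => rfl
  | symm f g _ ih => exact ih.symm
  | trans f g k _ _ ih ih' => exact ih.trans ih'

theorem SymMap.neg_eq (f : SymMap V 𝒰) : (fun z => f.toFun (-z)) = f.toFun := funext f.symm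

theorem SymMap.tailMatch (f : SymMap V 𝒰) : TailMatch V f.toFun f.toFun := by
  rw [tailMatch_iff, f.neg_eq]
  exact rayEquiv_of_shift f.born 0 0 fun _ _ => rfl

theorem IsString.append {a b c : RelFundGroupoid V 𝒰} {F G : List (ℤ → X)}
    (hF : IsString V 𝒰 a b F) (hG : IsString V 𝒰 b c G) : IsString V 𝒰 a c (F ++ G) := by
  obtain ⟨hF0, hF1, f₀, f₁, rfl, hb, hF2⟩ := hF
  obtain ⟨hG0, hG1, g₀, g₁, hb', rfl, hG2⟩ := hG
  refine ⟨by simp [hF0], ?_, f₀, g₁, rfl, rfl, ?_⟩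
  · intro f hf
    rcases List.mem_append.1 hf with hf | hf
    exacts [hF1 f hf, hG1 f hf]
  · obtain ⟨F', f, rfl⟩ := (List.eq_nil_or_concat F).resolve_left hF0
    obtain ⟨g, G', rfl⟩ := List.exists_cons_of_ne_nil hG0
    simp only [List.concat_eq_append, List.append_assoc, List.cons_append, List.nil_append,
      List.isChain_cons_cons] at hF2 hG2 ⊢
    have h1 := List.isChain_cons_append_cons_cons.1 hF2
    refine List.isChain_cons_append_cons_cons.2 ⟨h1.1, ?_, hG2.2⟩
    have h2 := tailMatch_iff.1 h1.2.1
    have h3 := tailMatch_iff.1 hG2.1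
    rw [f₁.neg_eq] at h2
    exact tailMatch_iff.2 ((h2.trans (rayEquiv_of_mk_eq (hb.trans hb'.symm))).trans h3)

theorem IsString.deleteOpposite {a b : RelFundGroupoid V 𝒰} {p q : List (ℤ → X)} {f g : ℤ → X}
    (hF : IsString V 𝒰 a b (p ++ f :: g :: q)) {N : ℤ} (h : ∀ z, f z = g (-(z + N)))
    (hpq : p ++ q ≠ []) : IsString V 𝒰 a b (p ++ q) := by
  obtain ⟨-, hF1, f₀, f₁, ha, hb, hF2⟩ := hF
  refine ⟨hpq, fun k hk => hF1 k ?_, f₀, f₁, ha, hb, ?_⟩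
  · rcases List.mem_append.1 hk with hk | hk <;> simp [hk]
  · have hf := (hF1 f (by simp)).1
    obtain ⟨s, l, hs⟩ : ∃ s l, f₀.toFun :: p = s ++ [l] := by
      obtain ⟨s, l, h⟩ := (List.eq_nil_or_concat (f₀.toFun :: p)).resolve_left (by simp)
      exact ⟨s, l, by simpa using h⟩
    obtain ⟨m, t, hm⟩ : ∃ m t, q ++ [f₁.toFun] = m :: t :=
      List.exists_cons_of_ne_nil (by simp)
    have e1 : f₀.toFun :: ((p ++ f :: g :: q) ++ [f₁.toFun]) = s ++ l :: f :: g :: m :: t := by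
      rw [List.append_assoc, List.cons_append, List.cons_append, hm, ← List.cons_append, hs]
      simp
    have e2 : f₀.toFun :: ((p ++ q) ++ [f₁.toFun]) = s ++ l :: m :: t := by
      rw [List.append_assoc, hm, ← List.cons_append, hs]
      simp
    rw [e1] at hF2
    rw [e2]
    rw [List.isChain_append_cons_cons] at hF2 ⊢
    simp only [List.isChain_cons_cons] at hF2
    obtain ⟨h1, h2, h3, h4, h5⟩ := hF2
    refine ⟨h1, ?_, h5⟩
    rw [tailMatch_iff] at h2 h4 ⊢
    refine h2.trans (RayEquiv.trans ?_ h4)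
    refine rayEquiv_of_shift (bornologous_neg hf) N 0 fun z _ => ?_
    rw [h]
    congr 1
    ring

theorem Move.append_right {F F' : List (ℤ → X)} (h : Move V F F') (G : List (ℤ → X)) :
    Move V (F ++ G) (F' ++ G) := by
  cases h with
  | deleteOpposite p q f g N h hpq =>
    have := Move.deleteOpposite (V := V) p (q ++ G) f g N h (by
      rw [← List.append_assoc]
      exact List.append_ne_nil_of_left_ne_nil hpq _)
    simpa using this
  | merge p q f g h j H => simpa using Move.merge p (q ++ G) f g h j H
  | deform _ _ H =>
    exact Move.deform _ _ (List.rel_append H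
      (List.forall₂_same.2 fun _ _ => Relation.EqvGen.refl _))

theorem Move.append_left {G G' : List (ℤ → X)} (h : Move V G G') (F : List (ℤ → X)) :
    Move V (F ++ G) (F ++ G') := by
  cases h with
  | deleteOpposite p q f g N h hpq =>
    have := Move.deleteOpposite (V := V) (F ++ p) q f g N h (by
      rw [List.append_assoc]
      exact List.append_ne_nil_of_right_ne_nil _ hpq)
    simpa using this
  | merge p q f g h j H => simpa using Move.merge (F ++ p) q f g h j H
  | deform _ _ H =>
    exact Move.deform _ _ (List.rel_append
      (List.forall₂_same.2 fun _ _ => Relation.EqvGen.refl _) H)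

/-- The class of a string. -/
def strMk {a b : RelFundGroupoid V 𝒰} (F : List (ℤ → X)) (hF : IsString V 𝒰 a b F) :
    StrClass a b := Quot.mk _ ⟨F, hF⟩

theorem isString_symm (f : SymMap V 𝒰) :
    IsString V 𝒰 (RelFundGroupoid.mk f) (RelFundGroupoid.mk f) [f.toFun, f.toFun] :=
  ⟨by simp, fun g hg => by
    obtain rfl : g = f.toFun := by simpa using hg
    exact ⟨f.born, f.ctrl⟩, f, f, rfl, rfl, by simp [f.tailMatch]⟩

theorem isString_id (a : RelFundGroupoid V 𝒰) :
    IsString V 𝒰 a a [(Quot.out a).toFun, (Quot.out a).toFun] := by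
  have h := isString_symm (Quot.out a)
  have e : RelFundGroupoid.mk (Quot.out a) = a := Quot.out_eq a
  rwa [e] at h

/-- The fundamental groupoid as a category: composition is concatenation of strings, written in
the order of the paths, and the identity of `⟨f⟩_∞` is the class of the string `(f, f)`. -/
noncomputable instance : Category (RelFundGroupoid V 𝒰) where
  Hom a b := StrClass a b
  id a := strMk _ (isString_id a)
  comp := fun f g => Quot.map₂ (fun F G => ⟨F.1 ++ G.1, F.2.append G.2⟩)
    (fun F _ _ h => Move.append_left h F.1) (fun _ _ G h => Move.append_right h G.1) f g
  id_comp := by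
    rintro a b ⟨F⟩
    exact Quot.sound (Move.deleteOpposite [] F.1 _ _ 0
      (fun z => by rw [add_zero, SymMap.symm]) F.2.1)
  comp_id := by
    rintro a b ⟨F⟩
    apply Quot.sound
    have := Move.deleteOpposite (V := V) F.1 [] (Quot.out b).toFun (Quot.out b).toFun 0
      (fun z => by rw [add_zero, SymMap.symm]) (by simpa using F.2.1)
    simpa using this
  assoc := by
    rintro a b c d ⟨F⟩ ⟨G⟩ ⟨H⟩
    exact congrArg (Quot.mk _) (Subtype.ext (List.append_assoc _ _ _))

/-- The string `F` traversed in the opposite direction. -/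
def opposite (F : List (ℤ → X)) : List (ℤ → X) := (F.map fun f z => f (-z)).reverse

theorem opposite_opposite (F : List (ℤ → X)) : opposite (opposite F) = F := by
  simp [opposite, List.map_reverse, Function.comp_def]

theorem IsString.opposite {a b : RelFundGroupoid V 𝒰} {F : List (ℤ → X)}
    (hF : IsString V 𝒰 a b F) : IsString V 𝒰 b a (opposite F) := by
  obtain ⟨h0, h1, f₀, f₁, ha, hb, h2⟩ := hF
  refine ⟨by simp [SemiCoarse.opposite, h0], ?_, f₁, f₀, hb, ha, ?_⟩
  · intro g hg
    simp only [SemiCoarse.opposite, List.mem_reverse, List.mem_map] at hg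
    obtain ⟨f, hf, rfl⟩ := hg
    refine ⟨bornologous_neg (h1 f hf).1, ?_⟩
    obtain ⟨⟨U, hU, m, hm⟩, ⟨U', hU', n, hn⟩⟩ := (h1 f hf).2
    exact ⟨⟨U', hU', -n, fun z hz => hn _ (by omega)⟩, ⟨U, hU, -m, fun z hz => hm _ (by omega)⟩⟩
  · have e : f₁.toFun :: (SemiCoarse.opposite F ++ [f₀.toFun]) =
        SemiCoarse.opposite (f₀.toFun :: (F ++ [f₁.toFun])) := by
      simp [SemiCoarse.opposite, f₀.neg_eq, f₁.neg_eq]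
    rw [e, SemiCoarse.opposite, List.isChain_reverse, List.isChain_map]
    refine h2.imp fun f g h => ?_
    rw [tailMatch_iff] at h ⊢
    simpa using h.symm

theorem eqvGen_opposite (K F : List (ℤ → X)) (hK : K ≠ []) {a b : RelFundGroupoid V 𝒰}
    (h : IsString V 𝒰 a b (K ++ (F ++ opposite F))) :
    ∃ h' : IsString V 𝒰 a b K, strMk _ h = strMk _ h' := by
  induction F using List.reverseRecOn with
  | nil => exact ⟨by simpa [opposite] using h, by simp [opposite]⟩
  | append_singleton F f ih =>
    have e : K ++ ((F ++ [f]) ++ opposite (F ++ [f])) =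
        (K ++ F) ++ f :: (fun z => f (-z)) :: opposite F := by simp [opposite]
    obtain ⟨g, hg⟩ : ∃ g : ℤ → X, g = fun z => f (-z) := ⟨_, rfl⟩
    have hf : ∀ z, f z = g (-(z + 0)) := by simp [hg]
    have hne : (K ++ F) ++ opposite F ≠ [] := by simp [hK]
    have h1 := h
    rw [e, ← hg] at h1
    have h2 := h1.deleteOpposite hf hne
    have h3 : IsString V 𝒰 a b (K ++ (F ++ opposite F)) := by simpa using h2
    obtain ⟨h', hh⟩ := ih h3
    refine ⟨h', Eq.trans (Quot.sound ?_) hh⟩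
    have := Move.deleteOpposite (V := V) (K ++ F) (opposite F) f g 0 hf hne
    rw [hg, ← e] at this
    simpa using this

theorem comp_opposite {a b : RelFundGroupoid V 𝒰} {F : List (ℤ → X)} (hF : IsString V 𝒰 a b F) :
    (show a ⟶ b from strMk _ hF) ≫ (show b ⟶ a from strMk _ hF.opposite) = 𝟙 a := by
  rw [← Category.id_comp ((show a ⟶ b from strMk _ hF) ≫ _)]
  obtain ⟨_, hh⟩ := eqvGen_opposite _ F (by simp)
    ((isString_id a).append (hF.append hF.opposite))
  exact hh

theorem isIso_hom {a b : RelFundGroupoid V 𝒰} (f : a ⟶ b) : IsIso f := by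
  obtain ⟨F, hF⟩ := f
  refine ⟨strMk _ hF.opposite, comp_opposite hF, ?_⟩
  have h := comp_opposite hF.opposite
  have e : (strMk _ hF.opposite.opposite : StrClass a b) = strMk F hF := by
    simp only [opposite_opposite]
  rw [e] at h
  exact h

noncomputable instance : Groupoid (RelFundGroupoid V 𝒰) := Groupoid.ofIsIso isIso_hom

end

/-! ### Functoriality for injective bornologous maps -/

section

variable {V : SemiCoarse X} {W : SemiCoarse Y} {𝒰 : Set (Set X)} {𝒲 : Set (Set Y)}

/-- An injective bornologous map `φ : X → Y` that carries every member of `𝒰` into a member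
of `𝒲`. -/
structure IsRelEmbedding (V : SemiCoarse X) (W : SemiCoarse Y) (𝒰 : Set (Set X)) (𝒲 : Set (Set Y))
    (φ : X → Y) : Prop where
  born : Bornologous V W φ
  inj : Function.Injective φ
  maps : ∀ U ∈ 𝒰, ∃ U' ∈ 𝒲, Set.MapsTo φ U U'

theorem IsRelEmbedding.ctrl {φ : X → Y} (hφ : IsRelEmbedding V W 𝒰 𝒲 φ) {f : ℤ → X}
    (hf : TailsControlled 𝒰 f) : TailsControlled 𝒲 (fun z => φ (f z)) := by
  obtain ⟨⟨U, hU, m, hm⟩, ⟨U', hU', n, hn⟩⟩ := hf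
  obtain ⟨T, hT, h⟩ := hφ.maps U hU
  obtain ⟨T', hT', h'⟩ := hφ.maps U' hU'
  exact ⟨⟨T, hT, m, fun z hz => h (hm z hz)⟩, ⟨T', hT', n, fun z hz => h' (hn z hz)⟩⟩

/-- Composition of a symmetric map with `φ`. -/
def SymMap.map {φ : X → Y} (hφ : IsRelEmbedding V W 𝒰 𝒲 φ) (f : SymMap V 𝒰) : SymMap W 𝒲 where
  toFun z := φ (f.toFun z)
  born := hφ.born.comp f.born
  symm z := congrArg φ (f.symm z)
  ctrl := hφ.ctrl f.ctrl

/-- The map `⟨f⟩_∞ ↦ ⟨φ ∘ f⟩_∞` on objects. -/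
def RelFundGroupoid.mapObj {φ : X → Y} (hφ : IsRelEmbedding V W 𝒰 𝒲 φ) :
    RelFundGroupoid V 𝒰 → RelFundGroupoid W 𝒲 :=
  Quot.map (SymMap.map hφ) (by
    rintro f g (⟨N, M, h⟩ | h)
    · exact Or.inl ⟨N, M, fun k => congrArg φ (h k)⟩
    · exact Or.inr (h.postcomp hφ.born))

/-- Componentwise composition of a string with `φ`. -/
def mapList (φ : X → Y) (F : List (ℤ → X)) : List (ℤ → Y) := F.map fun f z => φ (f z)

theorem IsString.map {φ : X → Y} (hφ : IsRelEmbedding V W 𝒰 𝒲 φ) {a b : RelFundGroupoid V 𝒰}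
    {F : List (ℤ → X)} (hF : IsString V 𝒰 a b F) :
    IsString W 𝒲 (RelFundGroupoid.mapObj hφ a) (RelFundGroupoid.mapObj hφ b) (mapList φ F) := by
  obtain ⟨h0, h1, f₀, f₁, rfl, rfl, h2⟩ := hF
  refine ⟨by simp [mapList, h0], ?_, f₀.map hφ, f₁.map hφ, rfl, rfl, ?_⟩
  · intro g hg
    simp only [mapList, List.mem_map] at hg
    obtain ⟨f, hf, rfl⟩ := hg
    exact ⟨hφ.born.comp (h1 f hf).1, hφ.ctrl (h1 f hf).2⟩
  · have e : (f₀.map hφ).toFun :: (mapList φ F ++ [(f₁.map hφ).toFun]) =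
        mapList φ (f₀.toFun :: (F ++ [f₁.toFun])) := by simp [mapList, SymMap.map]
    rw [e, mapList, List.isChain_map]
    refine h2.imp ?_
    rintro f g ⟨N, M, h⟩
    exact ⟨N, M, h.postcomp hφ.born⟩

theorem NoCycles.map {φ : X → Y} (hφ : IsRelEmbedding V W 𝒰 𝒲 φ) {g : ℤ → X} {j : ℤ}
    (h : NoCycles V g j) : NoCycles W (fun z => φ (g z)) j := by
  have hp : ∀ (f : ℤ → X) (a : ℤ), PeriodicRight (fun z => φ (f z)) a → PeriodicRight f a :=
    fun f a ⟨p, hp, h⟩ => ⟨p, hp, fun z hz => hφ.inj (h z hz)⟩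
  constructor
  · rintro h1 ⟨k, hk, h2⟩
    obtain ⟨c, hc⟩ := h.1 (hp _ _ h1) ⟨k, hk, hp _ _ h2⟩
    exact ⟨φ c, hc.postcomp hφ.born⟩
  · rintro h1 ⟨k, hk, h2⟩
    obtain ⟨c, hc⟩ := h.2 (hp _ _ h1) ⟨k, hk, hp _ _ h2⟩
    exact ⟨φ c, hc.postcomp hφ.born⟩

theorem DeleteEquiv.map {φ : X → Y} (hφ : IsRelEmbedding V W 𝒰 𝒲 φ) {f g : ℤ → X}
    (h : DeleteEquiv V f g) : DeleteEquiv W (fun z => φ (f z)) (fun z => φ (g z)) := by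
  induction h with
  | rel f g h =>
    obtain ⟨hf, hg, z₀, e, hc⟩ := h
    refine Relation.EqvGen.rel _ _ ⟨hφ.born.comp hf, hφ.born.comp hg, z₀, ?_, hc.map hφ⟩
    funext z
    rw [e]
    exact apply_ite φ _ _ _
  | refl f => exact Relation.EqvGen.refl _
  | symm f g _ ih => exact ih.symm
  | trans f g k _ _ ih ih' => exact ih.trans _ _ _ ih'

theorem Move.map {φ : X → Y} (hφ : IsRelEmbedding V W 𝒰 𝒲 φ) {F G : List (ℤ → X)}
    (h : Move V F G) : Move W (mapList φ F) (mapList φ G) := by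
  cases h with
  | deleteOpposite p q f g N h hpq =>
    simp only [mapList, List.map_append, List.map_cons]
    refine Move.deleteOpposite _ _ _ _ N (fun z => congrArg φ (h z)) ?_
    rw [← List.map_append]
    simpa using hpq
  | merge p q f g h j H =>
    obtain ⟨⟨x₀, N, M, h1, h2, h3⟩, e, hc⟩ := H
    simp only [mapList, List.map_append, List.map_cons]
    refine Move.merge _ _ _ _ _ j ⟨⟨φ x₀, N, M, fun z hz => congrArg φ (h1 z hz),
      fun z hz => congrArg φ (h2 z hz), h3⟩, ?_, hc.map hφ⟩
    funext z
    rw [e]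
    exact apply_ite φ _ _ _
  | deform _ _ H =>
    refine Move.deform _ _ ?_
    rw [mapList, mapList, List.forall₂_map_left_iff, List.forall₂_map_right_iff]
    exact H.imp fun f g h => h.map hφ

/-- The functor between relative fundamental groupoids induced by `φ`:
`⟨f⟩_∞ ↦ ⟨φ ∘ f⟩_∞` and `[f₁, …, fₙ] ↦ [φ ∘ f₁, …, φ ∘ fₙ]`. -/
noncomputable def mapFunctor {φ : X → Y} (hφ : IsRelEmbedding V W 𝒰 𝒲 φ) :
    RelFundGroupoid V 𝒰 ⥤ RelFundGroupoid W 𝒲 where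
  obj := RelFundGroupoid.mapObj hφ
  map := fun {a b} f => Quot.map (fun F : Str a b => (⟨mapList φ F.1, F.2.map hφ⟩ : Str _ _))
    (fun _ _ h => h.map hφ) f
  map_id := by
    intro a
    have h : ∀ (f : SymMap W 𝒲) (b : RelFundGroupoid W 𝒲)
        (hf : IsString W 𝒲 b b [f.toFun, f.toFun]), (strMk _ hf : b ⟶ b) = 𝟙 b := by
      intro f b hf
      refine (Category.id_comp (show b ⟶ b from strMk _ hf)).symm.trans ?_
      apply Quot.sound
      exact Move.deleteOpposite [_, _] [] f.toFun f.toFun 0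
        (fun z => by rw [add_zero, SymMap.symm]) (by simp)
    exact h ((Quot.out a).map hφ) _ ((isString_id a).map hφ)
  map_comp := by
    rintro a b c ⟨F⟩ ⟨G⟩
    exact congrArg (Quot.mk _) (Subtype.ext (List.map_append))

end

/-! ### The square of a cover and the family of all singletons -/

/-- The family of all singletons of `X`. -/
def singletons (X : Type u) : Set (Set X) := {U | ∃ x, U = {x}}

/-- The family `𝒰 ∩ A` of the traces on `A` of the members of `𝒰`. -/
def trace (𝒰 : Set (Set X)) (A : Set X) : Set (Set A) := {S | ∃ U ∈ 𝒰, S = Subtype.val ⁻¹' U}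

theorem isRelEmbedding_val (V : SemiCoarse X) (𝒰 : Set (Set X)) (A : Set X) :
    IsRelEmbedding (V.sub A) V (trace 𝒰 A) 𝒰 Subtype.val :=
  ⟨bornologous_val V A, Subtype.val_injective, by
    rintro _ ⟨U, hU, rfl⟩
    exact ⟨U, hU, fun x hx => hx⟩⟩

theorem isRelEmbedding_inclusion (V : SemiCoarse X) (𝒰 : Set (Set X)) {A B : Set X} (h : A ⊆ B) :
    IsRelEmbedding (V.sub A) (V.sub B) (trace 𝒰 A) (trace 𝒰 B) (Set.inclusion h) :=
  ⟨bornologous_inclusion V h, Set.inclusion_injective h, by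
    rintro _ ⟨U, hU, rfl⟩
    exact ⟨_, ⟨U, hU, rfl⟩, fun x hx => hx⟩⟩

/-- The groupoid `π_{≤1}(X, 𝒰)`. -/
noncomputable def relPi {X : Type u} (V : SemiCoarse X) (𝒰 : Set (Set X)) : Grpd.{u, u} :=
  Grpd.of (RelFundGroupoid V 𝒰)

/-- The functor `π_{≤1}(A, 𝒰 ∩ A) ⥤ π_{≤1}(X, 𝒰)`. -/
noncomputable def relPiVal {X : Type u} (V : SemiCoarse X) (𝒰 : Set (Set X)) (A : Set X) :
    relPi (V.sub A) (trace 𝒰 A) ⟶ relPi V 𝒰 :=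
  mapFunctor (isRelEmbedding_val V 𝒰 A)

/-- The functor `π_{≤1}(A, 𝒰 ∩ A) ⥤ π_{≤1}(B, 𝒰 ∩ B)` for `A ⊆ B`. -/
noncomputable def relPiIncl {X : Type u} (V : SemiCoarse X) (𝒰 : Set (Set X)) {A B : Set X}
    (h : A ⊆ B) : relPi (V.sub A) (trace 𝒰 A) ⟶ relPi (V.sub B) (trace 𝒰 B) :=
  mapFunctor (isRelEmbedding_inclusion V 𝒰 h)

/-- The constant map at `x`, a symmetric map with tails controlled by the singletons. -/
def constSym (V : SemiCoarse X) (x : X) : SymMap V (singletons X) where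
  toFun _ := x
  born := Bornologous.const _ _ _
  symm _ := rfl
  ctrl := ⟨⟨{x}, ⟨x, rfl⟩, 0, fun _ _ => rfl⟩, ⟨{x}, ⟨x, rfl⟩, 0, fun _ _ => rfl⟩⟩

/-- The object `⟨x̂⟩_∞`, where `x̂` is the constant map at `x`. -/
def basePoint (V : SemiCoarse X) (x : X) : RelFundGroupoid V (singletons X) :=
  RelFundGroupoid.mk (constSym V x)

theorem Loop.isString {V : SemiCoarse X} {x : X} (f : Loop V x) :
    IsString V (singletons X) (V.basePoint x) (V.basePoint x) [f.toFun] := by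
  have hc : SemiCoarse.Homotopic (ray 0) V (fun _ => x) (fun _ => x) :=
    SemiCoarse.Homotopic.refl (Bornologous.const _ _ _)
  refine ⟨by simp, ?_, V.constSym x, V.constSym x, rfl, rfl, ?_⟩
  · intro g hg
    obtain rfl : g = f.toFun := by simpa using hg
    exact ⟨f.born, ⟨{x}, ⟨x, rfl⟩, 0, fun z hz => f.left z hz⟩,
      ⟨{x}, ⟨x, rfl⟩, f.len, fun z hz => f.right z hz⟩⟩
  · simp only [List.cons_append, List.nil_append, List.isChain_cons_cons,
      List.isChain_singleton, and_true]
    refine ⟨⟨0, 0, ?_⟩, ⟨f.len, 0, ?_⟩⟩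
    · have e : (fun z : Set.Ici (0 : ℤ) => f.toFun (-(z : ℤ) + 0)) = fun _ => x :=
        funext fun z => f.left _ (by have := z.2; simp only [Set.mem_Ici] at this; omega)
      rw [e]
      exact hc
    · have e : (fun z : Set.Ici (0 : ℤ) => f.toFun ((z : ℤ) + f.len)) = fun _ => x :=
        funext fun z => f.right _ (by have := z.2; simp only [Set.mem_Ici] at this; omega)
      rw [e]
      exact hc

/-- The morphism `[f]` of the groupoid relative to the singletons given by the one-term string
of a loop `f` at `x`. -/
def Loop.toHom {V : SemiCoarse X} {x : X} (f : Loop V x) : V.basePoint x ⟶ V.basePoint x :=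
  strMk _ f.isString

end SemiCoarse

namespace SemiCoarse

/-! A tail controlled by singletons is constant, so the maps that occur have finite range, and for
such maps only the graph of adjacent pairs matters: a finite set is controlled as soon as each of
its pairs is. The objects of the groupoid are the components of this graph, a string is a sequence
of edge paths inside one component, and distinct objects are joined by no morphism
(`PointFamily.eq_of_hom`).

The main tool is a cocycle: a function on pairs of points with values in a group, multiplicative on
triangles of mutually adjacent points. Its product along a path survives all moves: deleting a point
is the triangle identity, merging multiplies, opposite paths have inverse products. Conversely, the
classes of edges form a tautological cocycle (`PointFamily.edgeCocycle`) and generate all morphisms.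
Hence a function on components, together with a cocycle for each component with values in the vertex
group of its image, defines a functor, and functors are determined by their values on points and
edges.

For the pushout, functors on the groupoids of `A` and `B` that agree on `A ∩ B` give cocycles that
glue to a cocycle `e` on the gluing. What remains is to extend it to `V`
(`WellSplit.exists_extension`): the value on an edge from `x` to `y` is `e x w * e w y` for a
midpoint `w`. Well-splitting is exactly what this needs. Condition (1) supplies midpoints, and a
common neighbour of the vertices of any triangle that is not in the gluing, so that such a triangle
is subdivided into three; condition (2) makes the value independent of `w`. Uniqueness holds because
every edge of `X` is a composite of two edges of the gluing.

For the fundamental group, a homotopy of loops is a grid of squares with adjacent diagonals, so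
products of cocycles along loops are homotopy invariant; the edge cocycle gives the required
homomorphism. For injectivity, choose a path (an arm) from `x` to every point of its component.
Going out along one arm, across an edge and back along another arm defines a cocycle with values in
the fundamental group (`PointFamily.armCocycle`). Its product along a loop `f` is `u * [f] * u⁻¹`
with `u` independent of `f`, so `[f]` can be recovered from the class of the string. -/

/-! ### The adjacency graph of a semi-coarse space -/

section Adjacency

variable {X Y : Type*} {V : SemiCoarse X} {W : SemiCoarse Y}

/-- Two points are adjacent if they form a controlled pair. -/
def Adj (V : SemiCoarse X) (x y : X) : Prop := {(x, y)} ∈ V.controlled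

theorem Adj.refl (V : SemiCoarse X) (x : X) : V.Adj x x :=
  V.subset_mem V.diag_mem (by rintro _ rfl; rfl)

theorem Adj.symm {x y : X} (h : V.Adj x y) : V.Adj y x :=
  V.subset_mem (V.inv_mem h) (by rintro _ rfl; exact ⟨(x, y), rfl, rfl⟩)

theorem adj_of_mem {S : Set (X × X)} (hS : S ∈ V.controlled) {x y : X} (h : (x, y) ∈ S) :
    V.Adj x y :=
  V.subset_mem hS (Set.singleton_subset_iff.2 h)

/-- Closure under finite unions assembles `S` from its one-point subsets. For infinite sets
adjacency of the pairs would not be enough. -/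
theorem controlled_of_finite {S : Set (X × X)} (hS : S.Finite) (h : ∀ p ∈ S, V.Adj p.1 p.2) :
    S ∈ V.controlled := by
  induction S, hS using Set.Finite.induction_on with
  | empty => exact V.subset_mem V.diag_mem (Set.empty_subset _)
  | @insert p S _ _ ih =>
    rw [Set.insert_eq]
    exact V.union_mem (h p (Set.mem_insert _ _)) (ih fun q hq => h q (Set.mem_insert_of_mem _ hq))

theorem Bornologous.adj {f : X → Y} (hf : Bornologous V W f) {x y : X} (h : V.Adj x y) :
    W.Adj (f x) (f y) :=
  adj_of_mem (hf _ h) ⟨(x, y), rfl, rfl⟩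

theorem bornologous_of_finite_range {f : X → Y} (hf : (Set.range f).Finite)
    (h : ∀ x y, V.Adj x y → W.Adj (f x) (f y)) : Bornologous V W f := by
  intro S hS
  refine controlled_of_finite ((hf.prod hf).subset ?_) ?_
  · rintro _ ⟨p, -, rfl⟩
    exact ⟨⟨p.1, rfl⟩, ⟨p.2, rfl⟩⟩
  · rintro _ ⟨p, hp, rfl⟩
    exact h _ _ (adj_of_mem hS hp)

theorem adj_Z1 {i j : ℤ} : Z1.Adj i j ↔ |i - j| ≤ 1 := by
  simp [Adj, Z1]

theorem adj_sub {A : Set X} {x y : A} : (V.sub A).Adj x y ↔ V.Adj x y := by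
  simp [Adj, sub]

theorem adj_prod {x x' : X} {y y' : Y} :
    (V.prod W).Adj (x, y) (x', y') ↔ V.Adj x x' ∧ W.Adj y y' := by
  constructor
  · rintro ⟨S, hS, T, hT, h⟩
    obtain ⟨h1, h2⟩ := h rfl
    exact ⟨adj_of_mem hS h1, adj_of_mem hT h2⟩
  · rintro ⟨h1, h2⟩
    exact ⟨_, h1, _, h2, by rintro _ rfl; exact ⟨rfl, rfl⟩⟩

theorem Bornologous.adj_succ {f : ℤ → X} (hf : Bornologous Z1 V f) (z : ℤ) :
    V.Adj (f z) (f (z + 1)) :=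
  hf.adj (adj_Z1.2 (by rw [abs_le]; omega))

theorem adj_of_adj_succ {f : ℤ → X} (h : ∀ z, V.Adj (f z) (f (z + 1))) {i j : ℤ}
    (hij : Z1.Adj i j) : V.Adj (f i) (f j) := by
  rw [adj_Z1, abs_le] at hij
  obtain rfl | rfl | rfl : j = i ∨ j = i + 1 ∨ i = j + 1 := by omega
  exacts [Adj.refl _ _, h _, (h _).symm]

/-- Induction along a path `{0, …, n} → X`. -/
theorem Connected.induction (hV : V.Connected) {P : X → Prop} {x y : X} (hx : P x)
    (h : ∀ a b, V.Adj a b → P a → P b) : P y := by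
  obtain ⟨n, γ, hγ, rfl, rfl⟩ := hV x y
  have : ∀ k : ℕ, ∀ hk : k ≤ n, P (γ ⟨k, by simp [hk]⟩) := by
    intro k
    induction k with
    | zero => exact fun _ => hx
    | succ k ih =>
      intro hk
      refine h _ _ (hγ.adj (adj_sub.2 (adj_Z1.2 ?_))) (ih (by omega))
      rw [abs_le]
      push_cast
      omega
  exact this n le_rfl

end Adjacency

/-! ### Paths that are constant near both ends -/

section Paths

variable {X : Type*} {V : SemiCoarse X}

/-- `f` is a path with constant value `x` near `-∞` and constant value `y` near `∞`. -/
structure IsPath (V : SemiCoarse X) (f : ℤ → X) (x y : X) : Prop where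
  adj : ∀ z, V.Adj (f z) (f (z + 1))
  left : ∃ m, ∀ z ≤ m, f z = x
  right : ∃ n, ∀ z ≥ n, f z = y

theorem finite_range_of_tails {f : ℤ → X} {x y : X} (hl : ∃ m, ∀ z ≤ m, f z = x)
    (hr : ∃ n, ∀ z ≥ n, f z = y) : (Set.range f).Finite := by
  obtain ⟨m, hm⟩ := hl
  obtain ⟨n, hn⟩ := hr
  refine ((Set.finite_Icc m n).image f |>.union (Set.toFinite {x, y})).subset ?_
  rintro _ ⟨z, rfl⟩
  by_cases h1 : z ≤ m
  · exact Or.inr (Or.inl (hm z h1))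
  · by_cases h2 : n ≤ z
    · exact Or.inr (Or.inr (hn z h2))
    · exact Or.inl ⟨z, ⟨by omega, by omega⟩, rfl⟩

theorem bornologous_of_adj_succ {f : ℤ → X} (hf : (Set.range f).Finite)
    (h : ∀ z, V.Adj (f z) (f (z + 1))) : Bornologous Z1 V f :=
  bornologous_of_finite_range hf fun _ _ => adj_of_adj_succ h

theorem IsPath.born {f : ℤ → X} {x y : X} (h : IsPath V f x y) : Bornologous Z1 V f :=
  bornologous_of_adj_succ (finite_range_of_tails h.left h.right) h.adj

theorem IsPath.neg {f : ℤ → X} {x y : X} (h : IsPath V f x y) :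
    IsPath V (fun z => f (-z)) y x := by
  obtain ⟨h0, ⟨m, hm⟩, ⟨n, hn⟩⟩ := h
  refine ⟨fun z => ?_, ⟨-n, fun z hz => hn _ (by omega)⟩, ⟨-m, fun z hz => hm _ (by omega)⟩⟩
  have := (h0 (-z - 1)).symm
  rwa [sub_add_cancel, ← neg_add' z 1] at this

/-- The path which jumps from `x` to `y` after time `s`. -/
def jump (x y : X) (s : ℤ) : ℤ → X := fun z => if z ≤ s then x else y

theorem isPath_jump {x y : X} (h : V.Adj x y) (s : ℤ) : IsPath V (jump x y s) x y := by
  refine ⟨fun z => ?_, ⟨s, fun z hz => if_pos hz⟩, ⟨s + 1, fun z hz => if_neg (by omega)⟩⟩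
  unfold jump
  split_ifs
  exacts [Adj.refl _ _, h, by omega, Adj.refl _ _]

theorem isPath_const (V : SemiCoarse X) (x : X) : IsPath V (fun _ => x) x x :=
  ⟨fun _ => Adj.refl _ _, ⟨0, fun _ _ => rfl⟩, ⟨0, fun _ _ => rfl⟩⟩

/-- The path `f`, kept constant after time `n`. -/
theorem IsPath.truncate {f : ℤ → X} {x y : X} (h : IsPath V f x y) (n : ℤ) :
    IsPath V (fun z => f (min z n)) x (f n) := by
  obtain ⟨h0, ⟨m, hm⟩, -⟩ := h
  refine ⟨fun z => ?_, ⟨m, fun z hz => hm _ (min_le_of_left_le hz)⟩,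
    ⟨n, fun z hz => by rw [min_eq_right hz]⟩⟩
  by_cases h : z + 1 ≤ n
  · rw [min_eq_left h, min_eq_left (by omega)]
    exact h0 z
  · rw [min_eq_right (by omega), min_eq_right (by omega)]
    exact Adj.refl _ _

theorem eq_of_periodicRight {g : ℤ → X} {y : X} {a : ℤ} (hg : ∃ n, ∀ z ≥ n, g z = y)
    (h : PeriodicRight g a) {z : ℤ} (hz : a ≤ z) : g z = y := by
  obtain ⟨n, hn⟩ := hg
  obtain ⟨p, hp, h⟩ := h
  have key : ∀ k : ℕ, g (z + k * p) = g z := by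
    intro k
    induction k with
    | zero => simp
    | succ k ih =>
      rw [← ih, ← h (z + k * p) (by nlinarith [Int.natCast_nonneg k])]
      congr 1
      push_cast
      ring
  -- The period is at least 1, so `n - z` periods lead from `z` beyond `n`.
  rw [← key (n - z).toNat]
  apply hn
  have : n - z ≤ ((n - z).toNat : ℤ) := Int.self_le_toNat _
  nlinarith [Int.natCast_nonneg (n - z).toNat]

theorem homotopic_const_of_periodicRight {g : ℤ → X} {y : X} {j : ℤ}
    (hg : ∃ n, ∀ z ≥ n, g z = y) (h : PeriodicRight g (j - 1)) :
    ∃ c, Homotopic (ray j) V (fun z => g z) (fun _ => c) := by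
  refine ⟨y, ?_⟩
  have : (fun z : Set.Ici j => g z) = fun _ => y := funext fun z =>
    eq_of_periodicRight hg h (by have := z.2; simp only [Set.mem_Ici] at this; omega)
  rw [this]
  exact Homotopic.refl (Bornologous.const _ _ _)

/-- A periodic tail of an eventually constant map is constant, so the no-cycles condition never
obstructs a move whose result is a path. -/
theorem IsPath.noCycles {g : ℤ → X} {x y : X} (h : IsPath V g x y) (j : ℤ) : NoCycles V g j := by
  refine ⟨fun h1 _ => homotopic_const_of_periodicRight h.right h1, fun h1 _ => ?_⟩
  rw [neg_add'] at h1
  exact homotopic_const_of_periodicRight (g := fun z => g (-z)) h.neg.right h1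

end Paths

/-! ### Cocycles and their products along paths -/

section Cocycles

variable {X : Type*} {V : SemiCoarse X} {H : Type*} [Group H]

/-- A function on pairs of points with values in a group, multiplicative on triangles. -/
structure Cocycle (V : SemiCoarse X) (H : Type*) [Group H] where
  /-- the values -/
  toFun : X → X → H
  mul : ∀ {x y z}, V.Adj x y → V.Adj y z → V.Adj x z → toFun x y * toFun y z = toFun x z

namespace Cocycle

instance : CoeFun (Cocycle V H) (fun _ => X → X → H) := ⟨toFun⟩

variable (e : Cocycle V H)

theorem self (x : X) : e x x = 1 := by
  have := e.mul (Adj.refl V x) (Adj.refl V x) (Adj.refl V x)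
  simpa using this

theorem swap {x y : X} (h : V.Adj x y) : e y x = (e x y)⁻¹ := by
  have := e.mul h h.symm (Adj.refl V x)
  rw [e.self] at this
  exact (inv_eq_of_mul_eq_one_right this).symm

/-- The product of the values of `e` on the `n` steps of `f` after time `a`. -/
def seg (f : ℤ → X) (a : ℤ) : ℕ → H
  | 0 => 1
  | n + 1 => seg f a n * e (f (a + n)) (f (a + n + 1))

variable {e} {f g : ℤ → X}

theorem seg_add (a : ℤ) (m n : ℕ) : e.seg f a (m + n) = e.seg f a m * e.seg f (a + m) n := by
  induction n with
  | zero => simp [seg]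
  | succ n ih =>
    rw [← add_assoc, seg, ih, seg, mul_assoc]
    push_cast
    simp only [add_assoc]

theorem seg_one (a : ℤ) : e.seg f a 1 = e (f a) (f (a + 1)) := by
  simp [seg]

theorem seg_congr_shift (s : ℤ) {a : ℤ} {n : ℕ} (h : ∀ z, a ≤ z → z ≤ a + n → f z = g (z + s)) :
    e.seg f a n = e.seg g (a + s) n := by
  induction n with
  | zero => rfl
  | succ n ih =>
    push_cast at h
    rw [seg, seg, ih fun z h1 h2 => h z h1 (by omega), h _ (by omega) (by omega),
      h _ (by omega) (by omega), add_right_comm _ 1 s, add_right_comm a n s]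

theorem seg_congr {a : ℤ} {n : ℕ} (h : ∀ z, a ≤ z → z ≤ a + n → f z = g z) :
    e.seg f a n = e.seg g a n := by
  simpa using seg_congr_shift (e := e) (g := g) 0 (by simpa using h)

theorem seg_const {a : ℤ} {n : ℕ} {x : X} (h : ∀ z, a ≤ z → z ≤ a + n → f z = x) :
    e.seg f a n = 1 := by
  induction n with
  | zero => rfl
  | succ n ih =>
    push_cast at h
    rw [seg, ih fun z h1 h2 => h z h1 (by omega), h _ (by omega) (by omega),
      h _ (by omega) (by omega), e.self, one_mul]

theorem seg_reverse (hf : ∀ z, V.Adj (f z) (f (z + 1))) {N : ℤ} (h : ∀ z, f z = g (-(z + N)))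
    (a : ℤ) (n : ℕ) : e.seg g a n = (e.seg f (-(a + n) - N) n)⁻¹ := by
  induction n with
  | zero => simp [seg]
  | succ n ih =>
    -- The last step of `g` is the first step of the corresponding segment of `f`, so the latter is
    -- split off in front.
    rw [seg, ih, add_comm n 1, seg_add, mul_inv_rev, seg_one]
    have h1 : f (-(a + (1 + n : ℕ)) - N) = g (a + n + 1) := by
      rw [h]; congr 1; push_cast; ring
    have h2 : f (-(a + (1 + n : ℕ)) - N + 1) = g (a + n) := by
      rw [h]; congr 1; push_cast; ring
    rw [← e.swap (hf _), h1, h2]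
    congr 3
    push_cast
    ring

/-- The product of the values of `e` along all steps of a path that is constant near both ends. -/
noncomputable def along (e : Cocycle V H) (f : ℤ → X) : H :=
  Classical.epsilon fun g => ∃ m n : ℤ, ∀ a ≤ m, ∀ k : ℕ, n ≤ a + k → e.seg f a k = g

/-- Steps inside the constant tails contribute `e x x = 1`, so all sufficiently long segments have
the same product and the value selected by `epsilon` is forced. -/
theorem along_eq {a : ℤ} {n : ℕ} (hl : ∀ z ≤ a, f z = f a)
    (hr : ∀ z, a + n ≤ z → f z = f (a + n)) : e.along f = e.seg f a n := by
  have h0 : ∀ b ≤ a, ∀ k : ℕ, a + n ≤ b + k → e.seg f b k = e.seg f a n := by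
    intro b hb k hk
    obtain ⟨c, rfl⟩ : ∃ c : ℕ, a = b + c := ⟨(a - b).toNat, by omega⟩
    obtain ⟨d, rfl⟩ : ∃ d : ℕ, k = c + n + d := ⟨k - c - n, by omega⟩
    rw [seg_add, seg_add, seg_const (n := c) (x := f (b + c)) (fun z _ h => hl z h),
      seg_const (n := d) (x := f (b + c + n)) (fun z h _ => hr z (by push_cast at h; omega)),
      one_mul, mul_one]
  obtain ⟨m', n', h1⟩ : ∃ m n : ℤ, ∀ a ≤ m, ∀ k : ℕ, n ≤ a + k → e.seg f a k = e.along f :=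
    Classical.epsilon_spec (p := fun g => ∃ m n : ℤ, ∀ a ≤ m, ∀ k : ℕ, n ≤ a + k → e.seg f a k = g)
      ⟨e.seg f a n, a, a + n, h0⟩
  rw [← h1 (min a m') (by omega) (max (a + n) n' - min a m').toNat (by omega)]
  exact h0 _ (by omega) _ (by omega)

theorem along_eq_of_tails {x y : X} {a : ℤ} {n : ℕ} (hl : ∀ z ≤ a, f z = x)
    (hr : ∀ z, a + n ≤ z → f z = y) : e.along f = e.seg f a n :=
  along_eq (fun z hz => by rw [hl z hz, hl a le_rfl]) (fun z hz => by rw [hr z hz, hr _ le_rfl])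

theorem along_jump (x y : X) (s : ℤ) : e.along (jump x y s) = e x y := by
  rw [along_eq_of_tails (f := jump x y s) (a := s) (n := 1) (x := x) (y := y)
    (fun z hz => if_pos hz)
    (fun z hz => if_neg (by push_cast at hz; omega)), seg_one]
  simp [jump]

/-- The two steps of `f` through `f z₀` become a single step of `g`. As `g` is bornologous, the
outer points of these steps are adjacent, which closes the triangle to which the cocycle identity
applies. -/
theorem along_deletePoint {x y : X} (h : DeletePoint V f g) (hf : IsPath V f x y) :
    IsPath V g x y ∧ e.along f = e.along g := by
  obtain ⟨-, hg, z₀, rfl, -⟩ := h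
  obtain ⟨h0, ⟨m, hm⟩, ⟨n, hn⟩⟩ := hf
  refine ⟨⟨hg.adj_succ, ⟨min m (z₀ - 1), fun z hz => ?_⟩, ⟨max n z₀, fun z hz => ?_⟩⟩, ?_⟩
  · rw [if_pos (by omega), hm z (by omega)]
  · rw [if_neg (by omega), hn _ (by omega)]
  · set a := min m (z₀ - 1) with ha
    obtain ⟨k, hk⟩ : ∃ k : ℕ, z₀ = a + k + 1 := ⟨(z₀ - 1 - a).toNat, by omega⟩
    obtain ⟨l, hl⟩ : ∃ l : ℕ, n ≤ z₀ + l := ⟨(n - z₀).toNat, by omega⟩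
    have hz := hg.adj_succ (z₀ - 1)
    simp only [sub_add_cancel, sub_lt_self_iff, zero_lt_one, if_true, lt_irrefl, if_false] at hz
    -- Both paths take `k` steps from `a` to `z₀ - 1`; then come two steps for `f` and one for `g`,
    -- followed by `l` steps into the right tail.
    rw [along_eq_of_tails (f := f) (a := a) (n := k + 1 + 1 + l) (x := x) (y := y)
        (fun z hz => hm z (by omega)) (fun z hz => hn z (by push_cast at hz; omega)),
      along_eq_of_tails (a := a) (n := k + 1 + l) (x := x) (y := y)
        (fun z hz => by rw [if_pos (by omega), hm z (by omega)])
        (fun z hz => by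
          push_cast at hz
          rw [if_neg (by omega), hn _ (by omega)]),
      seg_add, seg_add, seg_add, seg_add, seg_add, seg_one, seg_one, seg_one]
    rw [seg_congr_shift (f := fun z => if z < z₀ then f z else f (z + 1)) (g := f)
      (a := a + (k + 1 : ℕ)) (n := l) 1 (fun z h1 _ => if_neg (by push_cast at h1; omega)),
      seg_congr (f := fun z => if z < z₀ then f z else f (z + 1)) (g := f) (a := a) (n := k)
        (fun z _ h1 => if_pos (by omega)), if_pos (by omega), if_neg (by omega)]
    have e1 : a + (k : ℤ) = z₀ - 1 := by omega
    have e2 : a + ((k + 1 : ℕ) : ℤ) = z₀ := by push_cast; omega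
    have e3 : a + ((k + 1 + 1 : ℕ) : ℤ) = z₀ + 1 := by push_cast; omega
    rw [e3, e2, e1, sub_add_cancel, mul_assoc (e.seg f a k),
      e.mul (by simpa using h0 (z₀ - 1)) (h0 z₀) hz]

theorem isPath_of_deletePoint {x y : X} (h : DeletePoint V f g) (hg : IsPath V g x y) :
    IsPath V f x y := by
  obtain ⟨hf, -, z₀, rfl, -⟩ := h
  obtain ⟨-, ⟨m, hm⟩, ⟨n, hn⟩⟩ := hg
  refine ⟨hf.adj_succ, ⟨min m (z₀ - 1), fun z hz => ?_⟩, ⟨max n z₀ + 1, fun z hz => ?_⟩⟩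
  · rw [← hm z (by omega), if_pos (by omega)]
  · rw [← hn (z - 1) (by omega), if_neg (by omega), sub_add_cancel]

/-- The maps between `f` and `g` in a chain of deletions and additions are not assumed to have
constant tails. The equivalence of the path properties transports this information along the chain
in both directions. -/
theorem along_deleteEquiv (e : Cocycle V H) (h : DeleteEquiv V f g) {x y : X} :
    (IsPath V f x y ↔ IsPath V g x y) ∧ (IsPath V f x y → e.along f = e.along g) := by
  induction h with
  | rel f g h =>
    exact ⟨⟨fun hf => (along_deletePoint (e := e) h hf).1, isPath_of_deletePoint h⟩,
      fun hf => (along_deletePoint h hf).2⟩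
  | refl f => exact ⟨Iff.rfl, fun _ => rfl⟩
  | symm f g _ ih => exact ⟨ih.1.symm, fun h => (ih.2 (ih.1.2 h)).symm⟩
  | trans f g k _ _ ih ih' =>
    exact ⟨ih.1.trans ih'.1, fun h => (ih.2 h).trans (ih'.2 (ih.1.1 h))⟩

theorem along_merge {h : ℤ → X} {j : ℤ} (H : MergeAt V f g j h) {x y x' y' : X}
    (hf : IsPath V f x y) (hg : IsPath V g x' y') : e.along h = e.along f * e.along g := by
  obtain ⟨⟨x₀, N, M, h1, h2, h3, h4⟩, rfl, -⟩ := H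
  obtain ⟨-, ⟨m, hm⟩, -⟩ := hf
  obtain ⟨-, -, ⟨n, hn⟩⟩ := hg
  obtain ⟨k, hk⟩ : ∃ k : ℕ, j - k ≤ m := ⟨(j - m).toNat, by omega⟩
  obtain ⟨l, hl⟩ : ∃ l : ℕ, n ≤ j + l := ⟨(n - j).toNat, by omega⟩
  rw [along_eq_of_tails (f := f) (a := j - k) (n := k) (x := x) (y := x₀)
      (fun z hz => hm z (by omega)) (fun z hz => h1 z (by omega)),
    along_eq_of_tails (f := g) (a := j) (n := l) (x := x₀) (y := y')
      (fun z hz => h2 z (by omega)) (fun z hz => hn z (by omega)),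
    -- The additional step puts the right tail strictly after `j`, into the branch of `g`, even if
    -- `l = 0`. It contributes `e y' y' = 1`.
    along_eq_of_tails (a := j - k) (n := k + l + 1) (x := x) (y := y')
      (fun z hz => by rw [if_pos (by omega), hm z (by omega)])
      (fun z hz => by push_cast at hz; rw [if_neg (by omega), hn z (by omega)]),
    add_assoc, seg_add, sub_add_cancel]
  congr 1
  · exact seg_congr fun z _ h => if_pos (by omega)
  · rw [seg_congr (g := g), seg_add, seg_one, hn _ hl, hn _ (by omega), e.self, mul_one]
    intro z hz _
    split_ifs with h
    · rw [h1 z (by omega), h2 z (by omega)]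
    · rfl

theorem along_opposite {x y : X} (hf : IsPath V f x y) {N : ℤ} (h : ∀ z, f z = g (-(z + N))) :
    e.along f * e.along g = 1 := by
  obtain ⟨h0, ⟨m, hm⟩, ⟨n, hn⟩⟩ := hf
  have h' : ∀ z, g z = f (-z - N) := fun z => by rw [h]; congr 1; ring
  obtain ⟨k, hk⟩ : ∃ k : ℕ, n ≤ m + k := ⟨(n - m).toNat, by omega⟩
  rw [along_eq_of_tails (f := f) (a := m) (n := k) (x := x) (y := y) hm
      (fun z hz => hn z (by omega)),
    along_eq_of_tails (f := g) (a := -(m + k) - N) (n := k) (x := y) (y := x)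
      (fun z hz => by rw [h', hn]; omega) (fun z hz => by rw [h', hm]; omega),
    seg_reverse h0 h]
  ring_nf
  simp

end Cocycle

end Cocycles

/-! ### Relative fundamental groupoids for families of points -/

section PointFamily

variable {X : Type*} {V : SemiCoarse X} {𝒰 : Set (Set X)}

/-- A family of sets that contains all singletons and has no member with two points. -/
structure PointFamily (𝒰 : Set (Set X)) : Prop where
  singleton_mem : ∀ x, {x} ∈ 𝒰
  subsingleton : ∀ U ∈ 𝒰, U.Subsingleton

theorem pointFamily_singletons (X : Type*) : PointFamily (singletons X) :=
  ⟨fun x => ⟨x, rfl⟩, by rintro _ ⟨x, rfl⟩; exact Set.subsingleton_singleton⟩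

/-- The trace on `A` of the family of singletons also contains the empty set if `A` is not
everything. Point families, unlike families of all singletons, are therefore stable under traces, so
that `A`, `B`, `A ∩ B` and `X` can be treated alike. -/
theorem PointFamily.trace (h : PointFamily 𝒰) (A : Set X) : PointFamily (trace 𝒰 A) := by
  refine ⟨fun x => ⟨{(x : X)}, h.singleton_mem _, by ext; simp [Subtype.ext_iff]⟩, ?_⟩
  rintro _ ⟨U, hU, rfl⟩
  exact (h.subsingleton U hU).preimage Subtype.val_injective

theorem PointFamily.exists_isPath (h𝒰 : PointFamily 𝒰) {f : ℤ → X} (hf : Bornologous Z1 V f)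
    (hc : TailsControlled 𝒰 f) : ∃ x y, IsPath V f x y := by
  obtain ⟨⟨U, hU, m, hm⟩, ⟨U', hU', n, hn⟩⟩ := hc
  exact ⟨f m, f n, hf.adj_succ, ⟨m, fun z hz => h𝒰.subsingleton U hU (hm z hz) (hm m le_rfl)⟩,
    ⟨n, fun z hz => h𝒰.subsingleton U' hU' (hn z hz) (hn n le_rfl)⟩⟩

theorem PointFamily.tailsControlled (h𝒰 : PointFamily 𝒰) {f : ℤ → X} {x y : X}
    (hf : IsPath V f x y) : TailsControlled 𝒰 f := by
  obtain ⟨-, ⟨m, hm⟩, ⟨n, hn⟩⟩ := hf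
  exact ⟨⟨_, h𝒰.singleton_mem x, m, hm⟩, ⟨_, h𝒰.singleton_mem y, n, hn⟩⟩

/-- The constant map at `x`. -/
def PointFamily.const (h𝒰 : PointFamily 𝒰) (V : SemiCoarse X) (x : X) : SymMap V 𝒰 where
  toFun _ := x
  born := Bornologous.const _ _ _
  symm _ := rfl
  ctrl := h𝒰.tailsControlled (isPath_const V x)

/-- The object given by the constant map at `x`. -/
def PointFamily.pt (h𝒰 : PointFamily 𝒰) (V : SemiCoarse X) (x : X) : RelFundGroupoid V 𝒰 :=
  RelFundGroupoid.mk (h𝒰.const V x)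

/-! ### Objects as components of the adjacency graph. -/

variable (h𝒰 : PointFamily 𝒰)

theorem PointFamily.mk_eq_pt {f : SymMap V 𝒰} {x : X} (hx : ∃ n, ∀ z ≥ n, f.toFun z = x) :
    RelFundGroupoid.mk f = h𝒰.pt V x := by
  obtain ⟨n, hn⟩ := hx
  exact Quot.sound (Or.inl ⟨n.toNat, 0, fun k => hn _ (by omega)⟩)

theorem PointFamily.exists_pt (a : RelFundGroupoid V 𝒰) : ∃ x, h𝒰.pt V x = a := by
  obtain ⟨f⟩ := a
  obtain ⟨_, x, hf⟩ := h𝒰.exists_isPath f.born f.ctrl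
  exact ⟨x, (h𝒰.mk_eq_pt hf.right).symm⟩

/-- The homotopy ignores the position and jumps from `x` to `y` in the time coordinate. -/
theorem PointFamily.pt_eq_of_adj {x y : X} (h : V.Adj x y) : h𝒰.pt V x = h𝒰.pt V y := by
  have hb := (isPath_jump h 0).born
  refine Quot.sound (Or.inr ⟨fun p => jump x y 0 p.2, ?_, 0, 1, fun _ k hk => if_pos hk,
    fun _ k hk => if_neg (by omega)⟩)
  rintro U ⟨S, hS, T, hT, hU⟩
  refine V.subset_mem (hb T hT) ?_
  rintro _ ⟨p, hp, rfl⟩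
  exact ⟨_, (hU hp).2, rfl⟩

theorem int_induction_of_adj {P : X → Prop} {f : ℤ → X} (hf : ∀ z, V.Adj (f z) (f (z + 1)))
    (hP : ∀ x y, V.Adj x y → P x → P y) {i j : ℤ} (h : P (f i)) : P (f j) := by
  induction j using Int.inductionOn' (b := i) with
  | zero => exact h
  | succ k _ ih => exact hP _ _ (hf k) ih
  | pred k _ ih =>
    have := hf (k - 1)
    rw [sub_add_cancel] at this
    exact hP _ _ this.symm ih

theorem PointFamily.pt_apply_eq {f : ℤ → X} (hf : ∀ z, V.Adj (f z) (f (z + 1))) (i j : ℤ) :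
    h𝒰.pt V (f i) = h𝒰.pt V (f j) :=
  int_induction_of_adj (P := fun x => h𝒰.pt V (f i) = h𝒰.pt V x) hf
    (fun _ _ h h' => h'.trans (h𝒰.pt_eq_of_adj h)) rfl

theorem PointFamily.pt_eq_of_isPath {f : ℤ → X} {x y : X} (hf : IsPath V f x y) :
    h𝒰.pt V x = h𝒰.pt V y := by
  obtain ⟨h0, ⟨m, hm⟩, ⟨n, hn⟩⟩ := hf
  rw [← hm m le_rfl, ← hn n le_rfl]
  exact h𝒰.pt_apply_eq h0 _ _

/-- Maps whose tails are homotopic have tails in the same path component. -/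
theorem RayEquiv.induction {P : X → Prop} (hP : ∀ x y, V.Adj x y → P x → P y) {f g : ℤ → X}
    {x y : X} (h : RayEquiv V f g) (hf : ∃ n, ∀ z ≥ n, f z = x) (hg : ∃ n, ∀ z ≥ n, g z = y)
    (hx : P x) : P y := by
  obtain ⟨N, M, H, hH, s, t, hs, ht⟩ := h
  obtain ⟨m, hm⟩ := hf
  obtain ⟨n, hn⟩ := hg
  -- At the position `Z` both shifted tails have reached their constant values, so the homotopy
  -- restricted to `Z` is a walk from `x` to `y`.
  set Z : Set.Ici (0 : ℤ) := ⟨max 0 (max (m - N) (n - M)), by simp⟩ with hZ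
  have hadj : ∀ k : ℤ, V.Adj (H (Z, k)) (H (Z, k + 1)) := fun k =>
    hH.adj (adj_prod.2 ⟨Adj.refl _ _, adj_Z1.2 (by rw [abs_le]; omega)⟩)
  have h1 : H (Z, s) = x := (hs Z s le_rfl).trans (hm _ (by simp only [hZ]; omega))
  have h2 : H (Z, t) = y := (ht Z t le_rfl).trans (hn _ (by simp only [hZ]; omega))
  rw [← h2]
  rw [← h1] at hx
  exact int_induction_of_adj (f := fun k => H (Z, k)) hadj hP hx

/-- Together with `pt_eq_of_adj`, this identifies the objects with the components of the adjacency
graph: a property preserved by adjacency passes between points that define the same object. -/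
theorem PointFamily.induction_of_pt_eq {P : X → Prop} (hP : ∀ x y, V.Adj x y → P x → P y) {x y : X}
    (h : h𝒰.pt V x = h𝒰.pt V y) (hx : P x) : P y :=
  (rayEquiv_of_mk_eq h).induction hP ⟨0, fun _ _ => rfl⟩ ⟨0, fun _ _ => rfl⟩ hx

theorem PointFamily.pt_eq_of_tailMatch {f g : ℤ → X} {x y : X} (h : TailMatch V f g)
    (hf : ∃ n, ∀ z ≥ n, f z = x) (hg : ∃ m, ∀ z ≤ m, g z = y) : h𝒰.pt V x = h𝒰.pt V y := by
  obtain ⟨m, hm⟩ := hg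
  exact (tailMatch_iff.1 h).induction (P := fun z => h𝒰.pt V x = h𝒰.pt V z)
    (fun _ _ h h' => h'.trans (h𝒰.pt_eq_of_adj h)) hf ⟨-m, fun z hz => hm _ (by omega)⟩ rfl

/-! ### Strings as composites of paths and of edges. -/

theorem PointFamily.isString_singleton {a b : RelFundGroupoid V 𝒰} {f : ℤ → X} {x y : X}
    (hf : IsPath V f x y) (ha : h𝒰.pt V x = a) (hb : h𝒰.pt V y = b) : IsString V 𝒰 a b [f] := by
  refine ⟨by simp, ?_, h𝒰.const V x, h𝒰.const V y, ha, hb, ?_⟩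
  · intro g hg
    obtain rfl : g = f := by simpa using hg
    exact ⟨hf.born, h𝒰.tailsControlled hf⟩
  · have hb := hf.born
    obtain ⟨-, ⟨m, hm⟩, ⟨n, hn⟩⟩ := hf
    simp only [List.cons_append, List.nil_append, List.isChain_cons_cons,
      List.isChain_singleton, and_true]
    constructor
    · refine tailMatch_iff.2 (rayEquiv_of_shift (Bornologous.const _ _ _) 0 (-m) fun z hz => ?_)
      exact (hm _ (by omega)).symm
    · refine tailMatch_iff.2 (rayEquiv_of_shift hb n 0 fun z hz => ?_)
      exact hn _ (by omega)

/-- The string can be cut after `f`: the constant map at the final value `y` of `f` has the same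
right tail as `f`, so it can replace `f` as the symmetric map from which `L` starts. -/
theorem PointFamily.isString_cons {a b : RelFundGroupoid V 𝒰} {f : ℤ → X} {L : List (ℤ → X)}
    (h : IsString V 𝒰 a b (f :: L)) : ∃ x y, IsPath V f x y ∧ h𝒰.pt V x = a ∧
      (L = [] ∧ h𝒰.pt V y = b ∨ L ≠ [] ∧ IsString V 𝒰 (h𝒰.pt V y) b L) := by
  obtain ⟨-, h1, f₀, f₁, rfl, rfl, h2⟩ := h
  obtain ⟨x, y, hf⟩ := h𝒰.exists_isPath (h1 f (by simp)).1 (h1 f (by simp)).2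
  obtain ⟨p, x', hf₀⟩ := h𝒰.exists_isPath f₀.born f₀.ctrl
  obtain ⟨y', q, hf₁⟩ := h𝒰.exists_isPath f₁.born f₁.ctrl
  rw [List.cons_append, List.isChain_cons_cons] at h2
  refine ⟨x, y, hf, ?_, ?_⟩
  · rw [h𝒰.mk_eq_pt hf₀.right, h𝒰.pt_eq_of_tailMatch h2.1 hf₀.right hf.left]
  · have hr : RayEquiv V (fun _ => y) f := by
      obtain ⟨n, hn⟩ := hf.right
      exact rayEquiv_of_shift (Bornologous.const _ _ _) 0 n
        fun z hz => (hn _ (by omega)).symm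
    rcases L.eq_nil_or_concat with rfl | ⟨_, _, hL⟩
    · refine Or.inl ⟨rfl, ?_⟩
      simp only [List.nil_append, List.isChain_cons_cons, List.isChain_singleton, and_true] at h2
      rw [h𝒰.mk_eq_pt hf₁.right, h𝒰.pt_eq_of_tailMatch h2.2 hf.right hf₁.left]
      exact h𝒰.pt_eq_of_isPath hf₁
    · have hL' : L ≠ [] := by rw [hL]; simp
      refine Or.inr ⟨hL', hL', fun g hg => h1 g (by simp [hg]), h𝒰.const V y, f₁, rfl, rfl, ?_⟩
      obtain ⟨g, L, rfl⟩ := List.exists_cons_of_ne_nil hL'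
      simp only [List.cons_append, List.isChain_cons_cons] at h2 ⊢
      exact ⟨tailMatch_iff.2 (hr.trans (tailMatch_iff.1 h2.2.1)), h2.2.2⟩

/-- The class of a one-term string. -/
def PointFamily.pathHom {a b : RelFundGroupoid V 𝒰} {f : ℤ → X} {x y : X}
    (hf : IsPath V f x y) (ha : h𝒰.pt V x = a) (hb : h𝒰.pt V y = b) : a ⟶ b :=
  strMk [f] (h𝒰.isString_singleton hf ha hb)

theorem PointFamily.path_induction
    {P : ∀ {a b : RelFundGroupoid V 𝒰}, (a ⟶ b) → Prop}
    (comp : ∀ {a b c : RelFundGroupoid V 𝒰} (m : a ⟶ b) (m' : b ⟶ c), P m → P m' → P (m ≫ m'))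
    (path : ∀ {a b : RelFundGroupoid V 𝒰} {f : ℤ → X} {x y : X} (hf : IsPath V f x y)
      (ha : h𝒰.pt V x = a) (hb : h𝒰.pt V y = b), P (h𝒰.pathHom hf ha hb))
    {a b : RelFundGroupoid V 𝒰} (m : a ⟶ b) : P m := by
  suffices h : ∀ (L : List (ℤ → X)) (a : RelFundGroupoid V 𝒰) (hL : IsString V 𝒰 a b L),
      P (show a ⟶ b from strMk L hL) by
    obtain ⟨L, hL⟩ := m
    exact h L a hL
  intro L
  induction L with
  | nil => exact fun a hL => absurd rfl hL.1
  | cons f L ih =>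
    intro a hL
    obtain ⟨x, y, hf, ha, ⟨rfl, hb⟩ | ⟨-, hL'⟩⟩ := h𝒰.isString_cons hL
    · exact path hf ha hb
    · exact comp (h𝒰.pathHom hf ha rfl) (strMk L hL') (path _ _ _) (ih _ hL')

/-- A path stays in one component. The groupoid is therefore the disjoint union of its vertex
groups, and group-valued cocycles suffice to describe functors. -/
theorem PointFamily.eq_of_hom (h𝒰 : PointFamily 𝒰) {a b : RelFundGroupoid V 𝒰} (m : a ⟶ b) :
    a = b :=
  h𝒰.path_induction (P := fun {a b} _ => a = b) (fun _ _ h h' => h.trans h')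
    (fun hf ha hb => ha.symm.trans ((h𝒰.pt_eq_of_isPath hf).trans hb)) m

/-! ### Evaluation of cocycles on strings -/

variable {H : Type*} [Group H]

/-- The product of the values of a cocycle along a string. -/
noncomputable def Cocycle.evalList (e : Cocycle V H) (F : List (ℤ → X)) : H :=
  (F.map e.along).prod

/-- Each kind of move has its own reason: opposite paths have inverse products, merging multiplies
products, and deletion of a point is the triangle identity. -/
theorem PointFamily.evalList_eq_of_move (h𝒰 : PointFamily 𝒰) (e : Cocycle V H)
    {a b : RelFundGroupoid V 𝒰} {F G : List (ℤ → X)} (hF : IsString V 𝒰 a b F) (h : Move V F G) :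
    e.evalList F = e.evalList G := by
  have hp : ∀ f ∈ F, ∃ x y, IsPath V f x y := fun f hf =>
    h𝒰.exists_isPath (hF.2.1 f hf).1 (hF.2.1 f hf).2
  clear hF
  cases h with
  | deleteOpposite p q f g N h _ =>
    obtain ⟨x, y, hf⟩ := hp f (by simp)
    simp [Cocycle.evalList, ← mul_assoc, Cocycle.along_opposite hf h]
  | merge p q f g h j H =>
    obtain ⟨x, y, hf⟩ := hp f (by simp)
    obtain ⟨x', y', hg⟩ := hp g (by simp)
    simp [Cocycle.evalList, Cocycle.along_merge H hf hg, mul_assoc]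
  | deform _ _ H =>
    induction H with
    | nil => rfl
    | @cons f g F G h _ ih =>
      obtain ⟨x, y, hf⟩ := hp f (by simp)
      have h1 := (e.along_deleteEquiv h).2 hf
      have h2 := ih fun f hf => hp f (by simp [hf])
      simp only [Cocycle.evalList, List.map_cons, List.prod_cons] at h2 ⊢
      rw [h1, h2]

/-- The product of the values of a cocycle along a morphism. -/
noncomputable def PointFamily.eval (e : Cocycle V H) {a b : RelFundGroupoid V 𝒰} (m : a ⟶ b) : H :=
  Quot.lift (fun F : Str a b => e.evalList F.1) (fun F _ h => h𝒰.evalList_eq_of_move e F.2 h) m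

theorem PointFamily.eval_comp (e : Cocycle V H) {a b c : RelFundGroupoid V 𝒰} (m : a ⟶ b)
    (m' : b ⟶ c) : h𝒰.eval e (m ≫ m') = h𝒰.eval e m * h𝒰.eval e m' := by
  obtain ⟨F⟩ := m
  obtain ⟨G⟩ := m'
  change e.evalList (F.1 ++ G.1) = e.evalList F.1 * e.evalList G.1
  simp [Cocycle.evalList]

theorem PointFamily.eval_pathHom (e : Cocycle V H) {a b : RelFundGroupoid V 𝒰} {f : ℤ → X}
    {x y : X} (hf : IsPath V f x y) (ha : h𝒰.pt V x = a) (hb : h𝒰.pt V y = b) :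
    h𝒰.eval e (h𝒰.pathHom hf ha hb) = e.along f := by
  change e.evalList [f] = _
  simp [Cocycle.evalList]

theorem PointFamily.eval_id (e : Cocycle V H) (a : RelFundGroupoid V 𝒰) :
    h𝒰.eval e (𝟙 a) = 1 := by
  have := h𝒰.eval_comp e (𝟙 a) (𝟙 a)
  rw [Category.comp_id] at this
  exact left_eq_mul.1 this

/-! ### The tautological cocycle -/

/-- The class of an edge. -/
def PointFamily.edgeHom {a b : RelFundGroupoid V 𝒰} {x y : X} (h : V.Adj x y)
    (ha : h𝒰.pt V x = a) (hb : h𝒰.pt V y = b) : a ⟶ b :=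
  h𝒰.pathHom (isPath_jump h 0) ha hb

theorem PointFamily.pathHom_eq_of_deletePoint {a b : RelFundGroupoid V 𝒰} {f g : ℤ → X} {x y : X}
    (hf : IsPath V f x y) (hg : IsPath V g x y) (ha : h𝒰.pt V x = a) (hb : h𝒰.pt V y = b)
    (z₀ : ℤ) (h : g = fun z => if z < z₀ then f z else f (z + 1)) :
    h𝒰.pathHom hf ha hb = h𝒰.pathHom hg ha hb :=
  Quot.sound (Move.deform _ _ (List.Forall₂.cons
    (Relation.EqvGen.rel _ _ ⟨hf.born, hg.born, z₀, h, hg.noCycles _⟩) List.Forall₂.nil))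

/-- Deleting one repetition of `x` moves the jump from time `s + 1` to time `s`. -/
theorem PointFamily.pathHom_jump {a b : RelFundGroupoid V 𝒰} {x y : X} (h : V.Adj x y)
    (ha : h𝒰.pt V x = a) (hb : h𝒰.pt V y = b) (s : ℤ) :
    h𝒰.pathHom (isPath_jump h s) ha hb = h𝒰.edgeHom h ha hb := by
  have key : ∀ s, h𝒰.pathHom (isPath_jump h (s + 1)) ha hb =
      h𝒰.pathHom (isPath_jump h s) ha hb := by
    intro s
    refine h𝒰.pathHom_eq_of_deletePoint _ _ ha hb (s + 1) ?_
    funext z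
    unfold jump
    split_ifs <;> first | rfl | omega
  induction s using Int.induction_on with
  | zero => rfl
  | succ k ih => exact (key _).trans ih
  | pred k ih =>
    rw [← ih, ← key]
    congr 1
    simp

theorem PointFamily.pathHom_comp {a b c : RelFundGroupoid V 𝒰} {f g h : ℤ → X} {x y z : X}
    (hf : IsPath V f x y) (hg : IsPath V g y z) (hh : IsPath V h x z) (ha : h𝒰.pt V x = a)
    (hb : h𝒰.pt V y = b) (hc : h𝒰.pt V z = c) (j : ℤ) (h1 : ∀ z ≥ j, f z = y)
    (h2 : ∀ z ≤ j, g z = y) (h3 : ∀ z, h z = if z ≤ j then f z else g z) :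
    h𝒰.pathHom hf ha hb ≫ h𝒰.pathHom hg hb hc = h𝒰.pathHom hh ha hc :=
  Quot.sound (Move.merge [] [] f g h j
    ⟨⟨y, j, j, h1, h2, le_rfl, le_rfl⟩, funext h3, hh.noCycles _⟩)

/-- Merging a jump at time 0 with a jump at time 1 gives a path that visits `y` only at time 1.
Since `x` and `z` are adjacent, this visit may be deleted, which leaves the jump from `x` to `z`. -/
theorem PointFamily.edgeHom_comp {a b c : RelFundGroupoid V 𝒰} {x y z : X}
    (h1 : V.Adj x y) (h2 : V.Adj y z) (h3 : V.Adj x z) (ha : h𝒰.pt V x = a)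
    (hb : h𝒰.pt V y = b) (hc : h𝒰.pt V z = c) :
    h𝒰.edgeHom h1 ha hb ≫ h𝒰.edgeHom h2 hb hc = h𝒰.edgeHom h3 ha hc := by
  have hp : IsPath V (fun t => if t ≤ 0 then x else if t ≤ 1 then y else z) x z := by
    refine ⟨fun t => ?_, ⟨0, fun t ht => if_pos ht⟩,
      ⟨2, fun t ht => by rw [if_neg (by omega), if_neg (by omega)]⟩⟩
    split_ifs <;> first | exact Adj.refl _ _ | assumption | omega
  rw [← h𝒰.pathHom_jump h2 hb hc 1, edgeHom, edgeHom,
    h𝒰.pathHom_comp (isPath_jump h1 0) (isPath_jump h2 1) hp ha hb hc 1]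
  · refine h𝒰.pathHom_eq_of_deletePoint _ _ ha hc 1 ?_
    funext t
    unfold jump
    split_ifs <;> first | rfl | omega
  · exact fun t ht => if_neg (by omega)
  · exact fun t ht => if_pos ht
  · intro t
    unfold jump
    split_ifs <;> first | rfl | omega

open Classical in
/-- The cocycle which sends an edge of the component `c` to its class. -/
noncomputable def PointFamily.edgeCocycle (c : RelFundGroupoid V 𝒰) : Cocycle V (c ⟶ c) where
  toFun x y := if h : V.Adj x y ∧ h𝒰.pt V x = c then
    h𝒰.edgeHom h.1 h.2 ((h𝒰.pt_eq_of_adj h.1).symm.trans h.2) else 1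
  mul := by
    intro x y z h1 h2 h3
    have e := h𝒰.pt_eq_of_adj h1
    by_cases h : h𝒰.pt V x = c
    · rw [dif_pos ⟨h1, h⟩, dif_pos ⟨h2, e.symm.trans h⟩, dif_pos ⟨h3, h⟩]
      exact h𝒰.edgeHom_comp h1 h2 h3 _ _ _
    -- Adjacent points share their component, so outside `c` all three values are the default 1.
    · rw [dif_neg (fun h' => h h'.2), dif_neg (fun h' => h (e.trans h'.2)),
        dif_neg (fun h' => h h'.2), one_mul]

theorem PointFamily.edgeCocycle_apply {x y : X} (h : V.Adj x y) {c : RelFundGroupoid V 𝒰}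
    (hx : h𝒰.pt V x = c) (hy : h𝒰.pt V y = c) :
    h𝒰.edgeCocycle c x y = h𝒰.edgeHom h hx hy :=
  dif_pos ⟨h, hx⟩

/-- Truncating one step later amounts to composing with the jump along that step, so a path is the
composite of its edges. -/
theorem PointFamily.pathHom_eq_along {c : RelFundGroupoid V 𝒰} {f : ℤ → X} {x y : X}
    (hf : IsPath V f x y) (hx : h𝒰.pt V x = c) (hy : h𝒰.pt V y = c) :
    h𝒰.pathHom hf hx hy = (h𝒰.edgeCocycle c).along f := by
  obtain ⟨m, hm⟩ := hf.left
  obtain ⟨n, hn⟩ := hf.right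
  have hz : ∀ z, h𝒰.pt V (f z) = c := fun z => by
    rw [h𝒰.pt_apply_eq hf.adj z m, hm m le_rfl, hx]
  have key : ∀ k : ℕ, ∀ t : ℤ, t = m + k →
      h𝒰.pathHom (hf.truncate t) hx (hz _) = (h𝒰.edgeCocycle c).seg f m k := by
    intro k
    induction k with
    | zero =>
      rintro _ rfl
      -- Merging a constant path with itself returns it; its class is idempotent in a group, hence
      -- 1.
      have e : ∀ (g : ℤ → X) (z : X) (hz : h𝒰.pt V z = c) (hg : IsPath V g x z), (∀ t, g t = x) →
          h𝒰.pathHom hg hx hz = (1 : c ⟶ c) := by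
        intro g z hz hg h
        obtain rfl : g = fun _ => x := funext h
        obtain ⟨t, ht⟩ := hg.right
        obtain rfl : x = z := ht t le_rfl
        have := h𝒰.pathHom_comp hg hg hg hx hx hx 0 (fun _ _ => rfl) (fun _ _ => rfl)
          (fun _ => (ite_self _).symm)
        exact mul_eq_left.1 this
      exact e _ _ _ _ fun t => hm _ (by simp)
    | succ k ih =>
      intro t ht
      obtain rfl : t = m + k + 1 := by rw [ht]; push_cast; ring
      rw [Cocycle.seg, ← ih _ rfl, h𝒰.edgeCocycle_apply (hf.adj _) (hz _) (hz _),
        ← h𝒰.pathHom_jump (hf.adj _) (hz _) (hz _) (m + k)]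
      refine (h𝒰.pathHom_comp _ _ _ hx (hz _) (hz _) (m + k) ?_ ?_ ?_).symm
      · exact fun t ht => by rw [min_eq_right ht]
      · exact fun t ht => if_pos ht
      · intro t
        split_ifs with h
        · rw [min_eq_left (by omega), min_eq_left h]
        · rw [min_eq_right (by omega), jump, if_neg h]
  obtain ⟨k, hk⟩ : ∃ k : ℕ, n ≤ m + k := ⟨(n - m).toNat, by omega⟩
  rw [Cocycle.along_eq_of_tails (a := m) (n := k) hm (fun z hz => hn z (by omega)), ← key k _ rfl]
  have e : (fun z => f (min z (m + k))) = f := by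
    funext z
    rcases le_total z (m + k) with h | h
    · rw [min_eq_left h]
    · rw [min_eq_right h, hn _ hk, hn _ (by omega)]
  have e' : ∀ g, g = f → ∀ z, z = y → ∀ (hg : IsPath V g x z) (hz : h𝒰.pt V z = c),
      h𝒰.pathHom hf hx hy = h𝒰.pathHom hg hx hz := by
    rintro _ rfl _ rfl _ _
    rfl
  exact e' _ e _ (hn _ hk) _ _

/-- Every morphism is a composite of edges. -/
theorem PointFamily.edge_induction
    {P : ∀ {a b : RelFundGroupoid V 𝒰}, (a ⟶ b) → Prop}
    (comp : ∀ {a b c : RelFundGroupoid V 𝒰} (m : a ⟶ b) (m' : b ⟶ c), P m → P m' → P (m ≫ m'))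
    (edge : ∀ {c : RelFundGroupoid V 𝒰} {x y : X} (h : V.Adj x y)
      (ha : h𝒰.pt V x = c) (hb : h𝒰.pt V y = c), P (h𝒰.edgeHom h ha hb))
    {a b : RelFundGroupoid V 𝒰} (m : a ⟶ b) : P m := by
  refine h𝒰.path_induction comp ?_ m
  clear m a b
  intro a b f x y hf ha hb
  obtain rfl : a = b := ha.symm.trans ((h𝒰.pt_eq_of_isPath hf).trans hb)
  rw [h𝒰.pathHom_eq_along hf ha hb]
  obtain ⟨m, hm⟩ := hf.left
  obtain ⟨n, hn⟩ := hf.right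
  have hz : ∀ z, h𝒰.pt V (f z) = a := fun z => by
    rw [h𝒰.pt_apply_eq hf.adj z m, hm m le_rfl, ha]
  obtain ⟨k, hk⟩ : ∃ k : ℕ, n ≤ m + k := ⟨(n - m).toNat, by omega⟩
  rw [Cocycle.along_eq_of_tails (a := m) (n := k) hm (fun z hz => hn z (by omega))]
  clear hk
  induction k with
  | zero =>
    -- The empty product is the class of the degenerate edge from `x` to itself.
    rw [Cocycle.seg, ← (h𝒰.edgeCocycle a).self x,
      h𝒰.edgeCocycle_apply (Adj.refl V x) ha ha]
    exact edge _ _ _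
  | succ k ih =>
    rw [Cocycle.seg, h𝒰.edgeCocycle_apply (hf.adj _) (hz _) (hz _)]
    exact comp _ _ ih (edge _ _ _)

end PointFamily

/-! ### Cocycles and the fundamental group -/

section FundGroupEval

variable {X : Type*} {V : SemiCoarse X} {x : X} {H : Type*} [Group H]

theorem Loop.isPath (f : Loop V x) : IsPath V f.toFun x x :=
  ⟨f.born.adj_succ, ⟨0, f.left⟩, ⟨f.len, f.right⟩⟩

/-- In the product structure the diagonals of a unit square are controlled too. Each square of the
ladder thus splits into two triangles, and the cocycle identity pushes the vertical edge across it.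
-/
theorem Cocycle.ladder (e : Cocycle V H) {K : ℤ × ℤ → X} (hK : Bornologous (Z1.prod Z1) V K)
    (a t : ℤ) (n : ℕ) :
    e.seg (fun k => K (k, t)) a n * e (K (a + n, t)) (K (a + n, t + 1)) =
      e (K (a, t)) (K (a, t + 1)) * e.seg (fun k => K (k, t + 1)) a n := by
  have hadj : ∀ {i j s t : ℤ}, |i - j| ≤ 1 → |s - t| ≤ 1 → V.Adj (K (i, s)) (K (j, t)) :=
    fun h1 h2 => hK.adj (adj_prod.2 ⟨adj_Z1.2 h1, adj_Z1.2 h2⟩)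
  induction n with
  | zero => simp [seg]
  | succ n ih =>
    rw [seg, seg, ← mul_assoc, ← ih]
    push_cast
    rw [mul_assoc, mul_assoc, ← add_assoc, e.mul, e.mul]
    all_goals exact hadj (by rw [abs_le]; omega) (by rw [abs_le]; omega)

theorem Cocycle.along_eq_of_homotopic (e : Cocycle V H) {f g : Loop V x}
    (h : Loop.Homotopic f g) : e.along f.toFun = e.along g.toFun := by
  obtain ⟨m, K, hK, hx, M, N, hM, hN⟩ := h
  have key : ∀ t, e.along (fun k => K (k, t)) = e.seg (fun k => K (k, t)) 0 m := fun t =>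
    along_eq_of_tails (x := x) (y := x) (fun z hz => hx z t (Or.inl hz))
      (fun z hz => hx z t (Or.inr (by omega)))
  have step : ∀ t, e.along (fun k => K (k, t)) = e.along (fun k => K (k, t + 1)) := by
    intro t
    have := e.ladder hK 0 t m
    -- Both vertical sides of the ladder are constant at `x` and contribute 1.
    rwa [hx _ _ (Or.inr (by omega)), hx _ _ (Or.inr (by omega)), hx _ _ (Or.inl le_rfl),
      hx _ _ (Or.inl le_rfl), e.self, mul_one, one_mul, ← key, ← key] at this
  have all : ∀ k : ℕ, e.along (fun k => K (k, M)) = e.along (fun j => K (j, M + k)) := by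
    intro k
    induction k with
    | zero => simp
    | succ k ih =>
      rw [ih, step]
      push_cast
      rw [add_assoc]
  rw [← funext (fun k => hM k M le_rfl), ← funext (fun k => hN k (M + (N - M).toNat) (by omega))]
  exact all _

/-- The homomorphism from the fundamental group defined by a cocycle. -/
noncomputable def Cocycle.loopEval (e : Cocycle V H) (x : X) : V.FundGroup x →* H where
  toFun := Quot.lift (fun f => e.along f.toFun) fun _ _ h => e.along_eq_of_homotopic h
  map_one' := (along_eq_of_tails (a := 0) (n := 0) (x := x) (y := x) (fun _ _ => rfl)
    (fun _ _ => rfl)).trans rfl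
  map_mul' := by
    rintro ⟨f⟩ ⟨g⟩
    change e.along (f.star g).toFun = e.along f.toFun * e.along g.toFun
    rw [along_eq_of_tails (f := f.toFun) (a := 0) (n := f.len) f.left
        (fun z hz => f.right z (by omega)),
      along_eq_of_tails (f := g.toFun) (a := 0) (n := g.len) g.left
        (fun z hz => g.right z (by omega)),
      along_eq_of_tails (a := 0) (n := f.len + g.len) (f.star g).left
        (fun z hz => (f.star g).right z (by rw [zero_add] at hz; exact hz)), seg_add]
    congr 1
    · exact seg_congr fun z _ h => if_pos (by omega)
    · rw [seg_congr_shift (f := g.toFun) (g := (f.star g).toFun) f.len]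
      intro z h1 _
      simp only [Loop.star, Loop.concatAt]
      split_ifs with h
      · rw [f.right _ (by omega), g.left _ (by omega)]
      · rw [add_sub_cancel_right]

end FundGroupEval

/-! ### A cocycle with values in the fundamental group -/

section Arms

variable {X : Type*} {V : SemiCoarse X} {x : X}

/-- A path from `x` to `y`, parametrized by `[0, len]`. -/
structure Arm (V : SemiCoarse X) (x y : X) where
  /-- the path -/
  toFun : ℤ → X
  /-- the length -/
  len : ℕ
  adj : ∀ z, V.Adj (toFun z) (toFun (z + 1))
  left : ∀ z ≤ 0, toFun z = x
  right : ∀ z ≥ (len : ℤ), toFun z = y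

theorem Arm.finite_range {y : X} (α : Arm V x y) : (Set.range α.toFun).Finite :=
  finite_range_of_tails ⟨0, α.left⟩ ⟨α.len, α.right⟩

/-- A finite set of values reduces bornologousness of the homotopy to adjacency of values at
neighbouring grid points. -/
theorem Loop.homotopic_of_adj {f g : Loop V x} (m : ℕ) (K : ℤ → ℤ → X) {S : Set X}
    (hS : S.Finite) (hK : ∀ k t, K k t ∈ S)
    (hadj : ∀ i j s t : ℤ, |i - j| ≤ 1 → |s - t| ≤ 1 → V.Adj (K i s) (K j t))
    (hx : ∀ k t : ℤ, k ≤ 0 ∨ (m : ℤ) ≤ k → K k t = x) (M N : ℤ)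
    (hM : ∀ k, ∀ t ≤ M, K k t = f.toFun k) (hN : ∀ k, ∀ t ≥ N, K k t = g.toFun k) :
    Loop.Homotopic f g := by
  refine ⟨m, fun p => K p.1 p.2, bornologous_of_finite_range (hS.subset ?_) ?_, hx, M, N, hM, hN⟩
  · rintro _ ⟨p, rfl⟩
    exact hK _ _
  · rintro ⟨i, s⟩ ⟨j, t⟩ h
    rw [adj_prod, adj_Z1, adj_Z1] at h
    exact hadj _ _ _ _ h.1 h.2

/-- Such loops differ at most in the recorded length, which the direct limit forgets. -/
theorem Loop.mk_eq_of_toFun_eq {f g : Loop V x} (h : f.toFun = g.toFun) :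
    FundGroup.mk f = FundGroup.mk g := by
  apply Quot.sound
  refine ⟨max f.len g.len, fun p => f.toFun p.1, f.born.comp (Bornologous.fst _ _), ?_, 0, 0,
    fun _ _ _ => rfl, fun _ _ _ => by rw [h]⟩
  rintro k t (hk | hk)
  · exact f.left k hk
  · exact f.right k (by omega)

/-- Deleting a point does not change the class of a loop. -/
theorem Loop.mk_eq_of_delete {f g : Loop V x} (z₀ : ℤ)
    (h : ∀ z, g.toFun z = if z < z₀ then f.toFun z else f.toFun (z + 1)) :
    FundGroup.mk f = FundGroup.mk g := by
  have hf : ∀ {i j : ℤ}, |i - j| ≤ 1 → V.Adj (f.toFun i) (f.toFun j) :=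
    fun h => f.born.adj (adj_Z1.2 h)
  have hg : ∀ {i j : ℤ}, |i - j| ≤ 1 → V.Adj (g.toFun i) (g.toFun j) :=
    fun h => g.born.adj (adj_Z1.2 h)
  have hfg : ∀ i j : ℤ, |i - j| ≤ 1 →
      V.Adj (f.toFun i) (g.toFun (if j ≤ z₀ then j else j - 1)) := by
    intro i j hij
    have hij' := abs_le.1 hij
    rcases lt_trichotomy j z₀ with hj | rfl | hj
    · rw [if_pos hj.le, h, if_pos hj]
      exact hf hij
    · rw [if_pos le_rfl]
      by_cases hi : i < j
      · have := hg hij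
        rwa [h i, if_pos hi] at this
      · rw [h, if_neg (lt_irrefl _)]
        exact hf (by rw [abs_le]; omega)
    · rw [if_neg (by omega), h, if_neg (by omega), sub_add_cancel]
      exact hf hij
  apply Quot.sound
  -- For positive `t` the loop runs through `g` and repeats its value at `z₀ + t - 1`. At `t = 1`
  -- this is `f` with the value at `z₀` replaced by `f (z₀ + 1)`; afterwards the repetition moves to
  -- the right until it disappears in the constant tail.
  refine Loop.homotopic_of_adj (max f.len g.len + 1) (fun j t => if t ≤ 0 then f.toFun j else
      g.toFun (if j ≤ z₀ + t - 1 then j else j - 1))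
    ((finite_range_of_tails f.isPath.left f.isPath.right).union
      (finite_range_of_tails g.isPath.left g.isPath.right)) ?_ ?_ ?_ 0
    (max 1 (max f.len g.len + 2 - z₀)) ?_ ?_
  · intro k t
    split_ifs
    exacts [Or.inl ⟨_, rfl⟩, Or.inr ⟨_, rfl⟩, Or.inr ⟨_, rfl⟩]
  · intro i j s t hij hst
    have hst' := abs_le.1 hst
    have hij' := abs_le.1 hij
    by_cases hs : s ≤ 0
    · by_cases ht : t ≤ 0
      · rw [if_pos hs, if_pos ht]
        exact hf hij
      · obtain rfl : t = 1 := by omega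
        rw [if_pos hs, if_neg ht, add_sub_cancel_right]
        exact hfg i j hij
    · by_cases ht : t ≤ 0
      · obtain rfl : s = 1 := by omega
        rw [if_neg hs, if_pos ht, add_sub_cancel_right]
        exact (hfg j i (by rwa [abs_sub_comm])).symm
      · rw [if_neg hs, if_neg ht]
        apply hg
        rw [abs_le]
        split_ifs <;> omega
  · intro k t hk
    push_cast at hk
    by_cases ht : t ≤ 0
    · rw [if_pos ht]
      rcases hk with hk | hk
      exacts [f.left _ hk, f.right _ (by omega)]
    · rw [if_neg ht]
      rcases hk with hk | hk
      · exact g.left _ (by split_ifs <;> omega)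
      · exact g.right _ (by split_ifs <;> omega)
  · exact fun k t ht => if_pos ht
  · intro k t ht
    rw [if_neg (by omega)]
    split_ifs with hk
    · rfl
    · rw [g.right _ (by omega), g.right _ (by omega)]

/-! ### Loops that go out along one arm and back along another. -/

variable {a b c : X}

/-- Run along `α`, stay for time `i` at the point `p`, and return along `β`. -/
def Arm.splice (α : Arm V x a) (β : Arm V x b) (p : X) (hp : V.Adj a p) (hp' : V.Adj p b)
    (h : V.Adj a b) (i : ℕ) : Loop V x where
  toFun j := if j ≤ α.len then α.toFun j else if j ≤ α.len + i then p else
    β.toFun (α.len + i + 1 + β.len - j)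
  len := α.len + i + 1 + β.len
  born := by
    refine bornologous_of_adj_succ (((α.finite_range.union β.finite_range).union
      (Set.finite_singleton p)).subset ?_) fun z => ?_
    · rintro _ ⟨z, rfl⟩
      dsimp only
      split_ifs
      exacts [Or.inl (Or.inl ⟨_, rfl⟩), Or.inr rfl, Or.inl (Or.inr ⟨_, rfl⟩)]
    · split_ifs with h1 h2 h3 h4 h5
      · exact α.adj z
      · rwa [α.right z (by omega)]
      · rwa [α.right z (by omega), β.right _ (by omega)]
      · omega
      · exact Adj.refl _ _
      · rwa [β.right _ (by omega)]
      · omega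
      · omega
      · have := (β.adj (α.len + i + 1 + β.len - (z + 1))).symm
        rwa [show (α.len + i + 1 + β.len - (z + 1) + 1 : ℤ) = α.len + i + 1 + β.len - z by
          ring] at this
  left z hz := by rw [if_pos (by omega), α.left z hz]
  right z hz := by
    push_cast at hz
    rw [if_neg (by omega), if_neg (by omega), β.left _ (by omega)]

/-- The class of the loop which runs along `α` and returns along `β`. -/
def Arm.join (α : Arm V x a) (β : Arm V x b) (h : V.Adj a b) : V.FundGroup x :=
  FundGroup.mk (α.splice β a (Adj.refl V a) h h 0)

/-- The repetitions of `p` are deleted one by one; the last deletion is possible because `a` and `b`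
are adjacent. -/
theorem Arm.mk_splice (α : Arm V x a) (β : Arm V x b) (p : X) (hp : V.Adj a p) (hp' : V.Adj p b)
    (h : V.Adj a b) (i : ℕ) : FundGroup.mk (α.splice β p hp hp' h i) = α.join β h := by
  induction i with
  | zero =>
    refine Loop.mk_eq_of_toFun_eq (funext fun j => ?_)
    simp only [splice]
    split_ifs <;> first | rfl | omega
  | succ i ih =>
    rw [← ih]
    refine Loop.mk_eq_of_delete (α.len + 1) fun z => ?_
    simp only [splice]
    push_cast
    split_ifs <;> first | rfl | omega | skip
    congr 1
    ring

/-- In the product, `π` is traversed back to `x` and out again. This excursion is contracted to the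
end `b` of `π`, and waiting at `b` between `a` and `c` can then be deleted, as `a` and `c` are
adjacent. -/
theorem Arm.join_mul_join (α : Arm V x a) (π : Arm V x b) (β : Arm V x c) (h1 : V.Adj a b)
    (h2 : V.Adj b c) (h3 : V.Adj a c) : α.join π h1 * π.join β h2 = α.join β h3 := by
  -- The excursion from `b` to `x` and back occupies `2 * π.len + 1` points, all of which become
  -- `b`.
  rw [← α.mk_splice β b h1 h2 h3 (2 * π.len + 1)]
  apply Quot.sound
  have hα : ∀ {i j : ℤ}, |i - j| ≤ 1 → V.Adj (α.toFun i) (α.toFun j) :=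
    fun h => adj_of_adj_succ α.adj (adj_Z1.2 h)
  have hβ : ∀ {i j : ℤ}, |i - j| ≤ 1 → V.Adj (β.toFun i) (β.toFun j) :=
    fun h => adj_of_adj_succ β.adj (adj_Z1.2 h)
  have hπ : ∀ {i j : ℤ}, |i - j| ≤ 1 → V.Adj (π.toFun i) (π.toFun j) :=
    fun h => adj_of_adj_succ π.adj (adj_Z1.2 h)
  refine Loop.homotopic_of_adj (α.len + 2 * π.len + 2 + β.len)
    (fun j t => if j ≤ α.len then α.toFun j else if j ≤ α.len + 1 + 2 * π.len then
      π.toFun (max |j - (α.len + 1 + π.len)| t) else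
      β.toFun (α.len + 2 * π.len + 2 + β.len - j))
    ((α.finite_range.union β.finite_range).union π.finite_range) ?_ ?_ ?_ 0 π.len ?_ ?_
  · intro k t
    split_ifs
    exacts [Or.inl (Or.inl ⟨_, rfl⟩), Or.inr ⟨_, rfl⟩, Or.inl (Or.inr ⟨_, rfl⟩)]
  · have hle : ∀ i j s t : ℤ, |i - j| ≤ 1 → |s - t| ≤ 1 → i ≤ j → V.Adj
        (if i ≤ α.len then α.toFun i else if i ≤ α.len + 1 + 2 * π.len then
          π.toFun (max |i - (α.len + 1 + π.len)| s) else
          β.toFun (α.len + 2 * π.len + 2 + β.len - i))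
        (if j ≤ α.len then α.toFun j else if j ≤ α.len + 1 + 2 * π.len then
          π.toFun (max |j - (α.len + 1 + π.len)| t) else
          β.toFun (α.len + 2 * π.len + 2 + β.len - j)) := by
      intro i j s t hij hst hle
      have hij' := abs_le.1 hij
      split_ifs with h4 h5 h6 h7 h8 h9
      · exact hα hij
      · rw [α.right i (by omega), π.right _ (le_max_of_le_left (le_abs.2 (by omega)))]
        exact h1
      · omega
      · omega
      · apply hπ
        rw [abs_le] at hst ⊢
        rcases abs_cases (i - (α.len + 1 + π.len : ℤ)) with ⟨e, _⟩ | ⟨e, _⟩ <;>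
        rcases abs_cases (j - (α.len + 1 + π.len : ℤ)) with ⟨e', _⟩ | ⟨e', _⟩ <;>
        rw [e, e'] <;> omega
      · rw [β.right _ (by omega), π.right _ (le_max_of_le_left (le_abs.2 (by omega)))]
        exact h2
      · omega
      · omega
      · exact hβ (by rw [abs_le]; omega)
    intro i j s t hij hst
    rcases le_total i j with h | h
    · exact hle i j s t hij hst h
    · exact (hle j i t s (by rwa [abs_sub_comm]) (by rwa [abs_sub_comm]) h).symm
  · intro k t hk
    push_cast at hk
    rcases hk with hk | hk
    · rw [if_pos (by omega), α.left _ hk]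
    · rw [if_neg (by omega), if_neg (by omega), β.left _ (by omega)]
  · intro k t ht
    rw [max_eq_left (ht.trans (abs_nonneg _))]
    simp only [splice, Loop.star, Loop.concatAt]
    push_cast
    by_cases h4 : k ≤ α.len
    · rw [if_pos h4, if_pos (by omega), if_pos h4]
    · by_cases h5 : k ≤ α.len + 1 + π.len
      · rw [if_neg h4, if_pos (by omega), if_pos (by omega), if_neg h4, if_neg (by omega),
          abs_of_nonpos (by omega)]
        congr 1
        ring
      · by_cases h6 : k ≤ α.len + 1 + 2 * π.len
        · rw [if_neg h4, if_pos h6, if_neg (by omega), if_pos (by omega), abs_of_nonneg (by omega)]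
          congr 1
        · rw [if_neg h4, if_neg h6, if_neg (by omega), if_neg (by omega), if_neg (by omega)]
          congr 1
          ring
  · intro k t ht
    rw [π.right _ (le_max_of_le_right ht)]
    simp only [splice]
    push_cast
    split_ifs <;> first | rfl | omega

/-- The constant arm. -/
def Arm.const (V : SemiCoarse X) (x : X) : Arm V x x :=
  ⟨fun _ => x, 0, fun _ => Adj.refl _ _, fun _ _ => rfl, fun _ _ => rfl⟩

/-- The arm given by a loop up to time `t`. -/
def Loop.arm (f : Loop V x) (t : ℤ) : Arm V x (f.toFun t) where
  toFun z := f.toFun (min z t)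
  len := t.toNat
  adj := (f.isPath.truncate t).adj
  left z hz := f.left _ (min_le_of_left_le hz)
  right z hz := by rw [min_eq_right (by omega)]

/-- An arm, extended by one edge. -/
def Arm.extend (α : Arm V x a) (h : V.Adj a b) : Arm V x b where
  toFun z := if z ≤ α.len then α.toFun z else b
  len := α.len + 1
  adj z := by
    split_ifs with h1 h2
    · exact α.adj z
    · rwa [α.right z (by omega)]
    · omega
    · exact Adj.refl _ _
  left z hz := by rw [if_pos (by omega), α.left z hz]
  right z hz := if_neg (by push_cast at hz; omega)

/-- The loop runs along `f` to time `t + 1` and returns the same way. The homotopy lowers the latest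
time reached on `f` from `t + 1` to 0. -/
theorem Loop.arm_join_arm_succ (f : Loop V x) {t : ℤ} (ht : 0 ≤ t) :
    (f.arm t).join (f.arm (t + 1)) (f.born.adj_succ t) = 1 := by
  apply Quot.sound
  have hf : ∀ {i j : ℤ}, |i - j| ≤ 1 → V.Adj (f.toFun i) (f.toFun j) :=
    fun h => f.born.adj (adj_Z1.2 h)
  refine Loop.homotopic_of_adj (2 * t.toNat + 2)
    (fun j s => f.toFun (min (t + 1 - |j - (t + 1)|) (-s)))
    (finite_range_of_tails f.isPath.left f.isPath.right) (fun _ _ => ⟨_, rfl⟩) ?_ ?_ (-(t + 1)) 0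
    ?_ ?_
  · intro i j r s hij hrs
    apply hf
    rw [abs_le] at *
    rcases abs_cases (i - (t + 1)) with ⟨e, _⟩ | ⟨e, _⟩ <;>
    rcases abs_cases (j - (t + 1)) with ⟨e', _⟩ | ⟨e', _⟩ <;> rw [e, e'] <;> omega
  · intro k s hk
    refine f.left _ (min_le_of_left_le (sub_nonpos.2 (le_abs.2 ?_)))
    push_cast at hk
    omega
  · intro k s hs
    have := abs_nonneg (k - (t + 1))
    rw [min_eq_left (by omega)]
    simp only [Arm.splice, Loop.arm]
    push_cast
    split_ifs with h1 h2
    · rw [abs_of_nonpos (by omega)]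
      congr 1
      omega
    · omega
    · rw [abs_of_nonneg (by omega)]
      congr 1
      omega
  · exact fun k s hs => f.left _ (min_le_of_right_le (by omega))

theorem Loop.arm_join_const (f : Loop V x) {t : ℤ} (ht : f.len ≤ t) (h : V.Adj (f.toFun t) x) :
    (f.arm t).join (Arm.const V x) h = FundGroup.mk f := by
  refine Loop.mk_eq_of_toFun_eq (funext fun j => ?_)
  by_cases h1 : j ≤ t.toNat
  · exact (if_pos h1).trans (congrArg f.toFun (min_eq_left (by omega)))
  · refine (if_neg h1).trans (Eq.trans (ite_eq_right_iff.2 fun h2 => ?_) (f.right j ?_).symm)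
    · exact absurd h2 (by push_cast; rw [add_zero]; exact h1)
    · omega

theorem Loop.const_join_arm (f : Loop V x) {t : ℤ} (ht : t ≤ 0) (h : V.Adj x (f.toFun t)) :
    (Arm.const V x).join (f.arm t) h = 1 := by
  refine Loop.mk_eq_of_toFun_eq (g := Loop.refl V x) (funext fun j => ?_)
  by_cases h1 : j ≤ (0 : ℕ)
  · exact if_pos h1
  · have h2 : ¬ j ≤ ((0 : ℕ) : ℤ) + (0 : ℕ) := by simpa using h1
    refine (if_neg h1).trans ((if_neg h2).trans ?_)
    exact f.left _ (min_le_of_right_le ht)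

theorem Arm.join_self (α : Arm V x a) (h : V.Adj a a) : α.join α h = 1 :=
  mul_eq_left.1 (α.join_mul_join α α h h h)

theorem Arm.inv_join (α : Arm V x a) (β : Arm V x b) (h : V.Adj a b) :
    (α.join β h)⁻¹ = β.join α h.symm := by
  rw [inv_eq_iff_mul_eq_one, α.join_mul_join β α h h.symm (Adj.refl V a), join_self]

variable {𝒰 : Set (Set X)} (h𝒰 : PointFamily 𝒰)

theorem PointFamily.nonempty_arm (h𝒰 : PointFamily 𝒰) {y : X} (h : h𝒰.pt V x = h𝒰.pt V y) :
    Nonempty (Arm V x y) :=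
  h𝒰.induction_of_pt_eq (P := fun y => Nonempty (Arm V x y))
    (fun _ _ h ⟨α⟩ => ⟨α.extend h⟩) h ⟨Arm.const V x⟩

/-- An arm from `x` to a point of its component. -/
noncomputable def PointFamily.arm {y : X} (h : h𝒰.pt V x = h𝒰.pt V y) : Arm V x y :=
  (h𝒰.nonempty_arm h).some

open Classical in
/-- The cocycle with values in the fundamental group defined by a choice of arms. -/
noncomputable def PointFamily.armCocycle (V : SemiCoarse X) (x : X) :
    Cocycle V (V.FundGroup x) where
  toFun y z := if h : V.Adj y z ∧ h𝒰.pt V x = h𝒰.pt V y then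
    (h𝒰.arm h.2).join (h𝒰.arm (h.2.trans (h𝒰.pt_eq_of_adj h.1))) h.1 else 1
  mul := by
    intro y z w h1 h2 h3
    have e := h𝒰.pt_eq_of_adj h1
    by_cases h : h𝒰.pt V x = h𝒰.pt V y
    · rw [dif_pos ⟨h1, h⟩, dif_pos ⟨h2, h.trans e⟩, dif_pos ⟨h3, h⟩, Arm.join_mul_join]
    · rw [dif_neg (fun h' => h h'.2), dif_neg (fun h' => h (h'.2.trans e.symm)),
        dif_neg (fun h' => h h'.2), one_mul]

theorem PointFamily.armCocycle_apply {y z : X} (h : V.Adj y z) (hy : h𝒰.pt V x = h𝒰.pt V y)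
    (hz : h𝒰.pt V x = h𝒰.pt V z) :
    h𝒰.armCocycle V x y z = (h𝒰.arm hy).join (h𝒰.arm hz) h :=
  dif_pos ⟨h, hy⟩

/-- The chosen arms are compared with the truncations of `f`. Joins of consecutive truncations are
trivial, so the product telescopes to the comparison terms at the two ends. The element `u` goes out
along the arm chosen for `x` and returns by the constant arm. -/
theorem PointFamily.armCocycle_along :
    ∃ u : V.FundGroup x, ∀ f : Loop V x,
      (h𝒰.armCocycle V x).along f.toFun = u * FundGroup.mk f * u⁻¹ := by
  refine ⟨(h𝒰.arm (rfl : h𝒰.pt V x = h𝒰.pt V x)).join (Arm.const V x) (Adj.refl V x), fun f => ?_⟩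
  have hp : ∀ z, h𝒰.pt V x = h𝒰.pt V (f.toFun z) := fun z => by
    conv_lhs => rw [← f.left 0 le_rfl]
    exact h𝒰.pt_apply_eq f.isPath.adj 0 z
  have key : ∀ n : ℕ, (h𝒰.armCocycle V x).seg f.toFun 0 n =
      (h𝒰.arm (hp 0)).join (f.arm 0) (Adj.refl _ _) *
        (f.arm (0 + n)).join (h𝒰.arm (hp (0 + n))) (Adj.refl _ _) := by
    intro n
    induction n with
    | zero =>
      have : ∀ t, t = (0 : ℤ) → (h𝒰.arm (hp 0)).join (f.arm 0) (Adj.refl _ _) *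
          (f.arm t).join (h𝒰.arm (hp t)) (Adj.refl _ _) = 1 := by
        rintro _ rfl
        rw [Arm.join_mul_join (h3 := Adj.refl _ _), Arm.join_self]
      exact (this _ (by simp)).symm
    | succ n ih =>
      have hs := f.born.adj_succ (0 + n)
      have : ∀ t, t = (0 + n + 1 : ℤ) → (f.arm (0 + n + 1)).join (h𝒰.arm (hp (0 + n + 1)))
          (Adj.refl _ _) = (f.arm t).join (h𝒰.arm (hp t)) (Adj.refl _ _) := by
        rintro _ rfl
        rfl
      rw [Cocycle.seg, ih, h𝒰.armCocycle_apply hs (hp _) (hp _), mul_assoc,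
        Arm.join_mul_join (h3 := hs), ← this _ (by push_cast; ring),
        ← one_mul ((f.arm (0 + n + 1)).join _ _), ← f.arm_join_arm_succ (t := 0 + n) (by omega),
        Arm.join_mul_join (h3 := hs)]
  have h1 : ∀ y (hy : h𝒰.pt V x = h𝒰.pt V y) (h : V.Adj y x), y = x →
      (h𝒰.arm hy).join (Arm.const V x) h =
        (h𝒰.arm (rfl : h𝒰.pt V x = h𝒰.pt V x)).join (Arm.const V x) (Adj.refl V x) := by
    rintro _ _ _ rfl
    rfl
  have e1 : f.toFun 0 = x := f.left 0 le_rfl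
  have e2 : f.toFun (0 + f.len) = x := f.right _ (by omega)
  have a1 : V.Adj (f.toFun 0) x := by rw [e1]; exact Adj.refl _ _
  have a2 : V.Adj (f.toFun (0 + f.len)) x := by rw [e2]; exact Adj.refl _ _
  rw [Cocycle.along_eq_of_tails (a := 0) (n := f.len) f.left (fun z hz => f.right z (by omega)),
    key, ← Arm.join_mul_join _ (Arm.const V x) _ a1 a1.symm, f.const_join_arm le_rfl, mul_one,
    ← Arm.join_mul_join _ (Arm.const V x) (h𝒰.arm (hp _)) a2 a2.symm,
    f.arm_join_const (by omega), ← Arm.inv_join _ _ a2, h1 _ _ a1 e1, h1 _ _ a2 e2, mul_assoc]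

end Arms

/-- The map is evaluation of the edge cocycle on loops. Evaluating the arm cocycle on its values
yields conjugation by a fixed element, which is injective. -/
theorem exists_fundGroup_embedding {X : Type*} (V : SemiCoarse X) (x : X) :
    ∃ φ : V.FundGroup x → (V.basePoint x ⟶ V.basePoint x),
      Function.Injective φ ∧ φ 1 = 𝟙 (V.basePoint x) ∧ (∀ a b, φ (a * b) = φ a ≫ φ b) ∧
        ∀ f : SemiCoarse.Loop V x, φ (SemiCoarse.FundGroup.mk f) = f.toHom := by
  have h := pointFamily_singletons X
  have hφ : ∀ f : Loop V x,
      (h.edgeCocycle (V.basePoint x)).loopEval x (FundGroup.mk f) = f.toHom :=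
    fun f => (h.pathHom_eq_along f.isPath rfl rfl).symm
  refine ⟨(h.edgeCocycle (V.basePoint x)).loopEval x, ?_, map_one _, map_mul _, hφ⟩
  obtain ⟨u, hu⟩ := h.armCocycle_along (V := V) (x := x)
  have key : ∀ f : Loop V x, h.eval (h.armCocycle V x) f.toHom = u * FundGroup.mk f * u⁻¹ :=
    fun f => (h.eval_pathHom (h.armCocycle V x) f.isPath rfl rfl).trans (hu f)
  rintro ⟨f⟩ ⟨g⟩ hfg
  have := (hφ f).symm.trans (hfg.trans (hφ g))
  have := congrArg (h.eval (h.armCocycle V x)) this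
  rw [key, key] at this
  exact mul_left_cancel (mul_right_cancel this)

/-! ### Functors on relative fundamental groupoids -/

section Functors

variable {X Y : Type*} {V : SemiCoarse X} {W : SemiCoarse Y} {𝒰 : Set (Set X)} {𝒲 : Set (Set Y)}
  {K : Type*} [Groupoid K]

theorem PointFamily.mapFunctor_map_edgeHom (h𝒰 : PointFamily 𝒰) (h𝒲 : PointFamily 𝒲) {φ : X → Y}
    (hφ : IsRelEmbedding V W 𝒰 𝒲 φ) {a b : RelFundGroupoid V 𝒰} {x y : X} (h : V.Adj x y)
    (ha : h𝒰.pt V x = a) (hb : h𝒰.pt V y = b) :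
    (mapFunctor hφ).map (h𝒰.edgeHom h ha hb) =
      h𝒲.edgeHom (a := (mapFunctor hφ).obj a) (b := (mapFunctor hφ).obj b) (hφ.born.adj h)
        (by rw [← ha]; rfl) (by rw [← hb]; rfl) := by
  refine congrArg (Quot.mk _) (Subtype.ext ?_)
  change [fun z => φ (jump x y 0 z)] = [jump (φ x) (φ y) 0]
  congr 1
  funext z
  exact apply_ite φ _ _ _

/-- Two functors which agree on points and edges are equal. -/
theorem PointFamily.functor_ext (h𝒰 : PointFamily 𝒰) {F G : RelFundGroupoid V 𝒰 ⥤ K}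
    (hobj : ∀ x, F.obj (h𝒰.pt V x) = G.obj (h𝒰.pt V x))
    (hmap : ∀ {x y : X} (h : V.Adj x y),
      HEq (F.map (h𝒰.edgeHom h rfl (h𝒰.pt_eq_of_adj h).symm))
        (G.map (h𝒰.edgeHom h rfl (h𝒰.pt_eq_of_adj h).symm))) : F = G := by
  have hobj' : ∀ a, F.obj a = G.obj a := fun a => by
    obtain ⟨x, rfl⟩ := h𝒰.exists_pt a
    exact hobj x
  refine Functor.hext hobj' fun a b m => ?_
  refine h𝒰.edge_induction (P := fun m => HEq (F.map m) (G.map m)) ?_ ?_ m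
  · intro a b c m m' h h'
    rw [F.map_comp, G.map_comp]
    exact heq_comp (hobj' _) (hobj' _) (hobj' _) h h'
  · rintro _ x y h rfl _
    exact hmap h

theorem eqToHom_comp_comp_eqToHom_heq {a b c d : K} (h : a = b) (f : b ⟶ c) (h' : c = d) :
    HEq (eqToHom h ≫ f ≫ eqToHom h') f := by
  subst h h'
  simp

/-- The functor defined by a function on objects and a cocycle for every component. -/
noncomputable def PointFamily.functorOfCocycle (h𝒰 : PointFamily 𝒰) (o : RelFundGroupoid V 𝒰 → K)
    (e : ∀ c, Cocycle V (o c ⟶ o c)) : RelFundGroupoid V 𝒰 ⥤ K where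
  obj := o
  -- Source and target of `m` are equal only propositionally: the cocycle of the source is evaluated
  -- and the result is transported to the target.
  map {a _} m := (show o a ⟶ o a from h𝒰.eval (e a) m) ≫
    eqToHom (congrArg o (h𝒰.eq_of_hom m))
  map_id a := by
    rw [h𝒰.eval_id, eqToHom_refl, Category.comp_id]
    rfl
  map_comp m m' := by
    obtain rfl := h𝒰.eq_of_hom m
    obtain rfl := h𝒰.eq_of_hom m'
    rw [h𝒰.eval_comp]
    simp only [eqToHom_refl, Category.comp_id]
    rfl

theorem PointFamily.functorOfCocycle_map_edgeHom (h𝒰 : PointFamily 𝒰)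
    (o : RelFundGroupoid V 𝒰 → K) (e : ∀ c, Cocycle V (o c ⟶ o c)) {c : RelFundGroupoid V 𝒰}
    {x y : X} (h : V.Adj x y) (hx : h𝒰.pt V x = c) (hy : h𝒰.pt V y = c) :
    (h𝒰.functorOfCocycle o e).map (h𝒰.edgeHom h hx hy) = e c x y := by
  change h𝒰.eval (e c) (h𝒰.edgeHom h hx hy) ≫ eqToHom _ = _
  rw [eqToHom_refl, Category.comp_id, edgeHom, h𝒰.eval_pathHom, Cocycle.along_jump]

open Classical in
/-- The cocycle with values in the vertex group of `k` defined by a functor which sends the objects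
in `S` to `k`. -/
noncomputable def PointFamily.functorCocycle (h𝒰 : PointFamily 𝒰) (F : RelFundGroupoid V 𝒰 ⥤ K)
    {k : K} {S : Set (RelFundGroupoid V 𝒰)} (hS : ∀ a ∈ S, F.obj a = k) : Cocycle V (k ⟶ k) where
  toFun x y := if h : V.Adj x y ∧ h𝒰.pt V x ∈ S then
    eqToHom (hS _ h.2).symm ≫ F.map (h𝒰.edgeHom h.1 rfl (h𝒰.pt_eq_of_adj h.1).symm) ≫
      eqToHom (hS _ h.2) else 1
  mul := by
    intro x y z h1 h2 h3
    have e := h𝒰.pt_eq_of_adj h1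
    by_cases h : h𝒰.pt V x ∈ S
    -- The second edge is based at the object of `y`; it is transported to the object of `x`, where
    -- it can be composed with the first.
    · have key : ∀ c (hc : c ∈ S) (hy : h𝒰.pt V y = c) (hz : h𝒰.pt V z = c),
          eqToHom (hS _ (hy ▸ hc)).symm ≫ F.map (h𝒰.edgeHom h2 rfl (h𝒰.pt_eq_of_adj h2).symm) ≫
            eqToHom (hS _ (hy ▸ hc)) =
          eqToHom (hS _ hc).symm ≫ F.map (h𝒰.edgeHom h2 hy hz) ≫ eqToHom (hS _ hc) := by
        rintro _ _ rfl _
        rfl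
      rw [dif_pos ⟨h1, h⟩, dif_pos ⟨h2, e ▸ h⟩, dif_pos ⟨h3, h⟩,
        key _ h e.symm (h𝒰.pt_eq_of_adj h3).symm,
        ← h𝒰.edgeHom_comp h1 h2 h3 rfl e.symm (h𝒰.pt_eq_of_adj h3).symm, F.map_comp]
      simp [Groupoid.vertexGroup_mul]
    · rw [dif_neg (fun h' => h h'.2), dif_neg (fun h' => h (e ▸ h'.2)),
        dif_neg (fun h' => h h'.2), one_mul]

theorem PointFamily.functorCocycle_heq (h𝒰 : PointFamily 𝒰) (F : RelFundGroupoid V 𝒰 ⥤ K)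
    {k : K} {S : Set (RelFundGroupoid V 𝒰)} (hS : ∀ a ∈ S, F.obj a = k) {x y : X}
    (h : V.Adj x y) (hx : h𝒰.pt V x ∈ S) :
    HEq (h𝒰.functorCocycle F hS x y)
      (F.map (h𝒰.edgeHom h rfl (h𝒰.pt_eq_of_adj h).symm)) := by
  have : h𝒰.functorCocycle F hS x y = eqToHom (hS _ hx).symm ≫
      F.map (h𝒰.edgeHom h rfl (h𝒰.pt_eq_of_adj h).symm) ≫ eqToHom (hS _ hx) := dif_pos ⟨h, hx⟩
  rw [this]
  exact eqToHom_comp_comp_eqToHom_heq _ _ _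

theorem PointFamily.functorCocycle_eq_one (h𝒰 : PointFamily 𝒰) (F : RelFundGroupoid V 𝒰 ⥤ K)
    {k : K} {S : Set (RelFundGroupoid V 𝒰)} (hS : ∀ a ∈ S, F.obj a = k) {x y : X}
    (hx : h𝒰.pt V x ∉ S) : h𝒰.functorCocycle F hS x y = 1 :=
  dif_neg fun h => hx h.2

end Functors

/-! ### Well-split spaces -/

section WellSplit

variable {X : Type*} {V : SemiCoarse X} {A B : Set X}

theorem mem_gluing {h : A ∪ B = Set.univ} {S : Set (X × X)} :
    S ∈ (V.gluing A B h).controlled ↔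
      S ∈ V.controlled ∧ ∀ p ∈ S, (p.1 ∈ A ∧ p.2 ∈ A) ∨ (p.1 ∈ B ∧ p.2 ∈ B) := by
  constructor
  · rintro ⟨_, ⟨S, hS, T, hT, rfl⟩, rfl⟩
    rw [Set.image_union, Set.image_image, Set.image_image]
    refine ⟨V.union_mem hS hT, ?_⟩
    rintro _ (⟨p, -, rfl⟩ | ⟨p, -, rfl⟩)
    · exact Or.inl ⟨p.1.2, p.2.2⟩
    · exact Or.inr ⟨p.1.2, p.2.2⟩
  · rintro ⟨hS, hp⟩
    refine ⟨_, ⟨{p | ((p.1 : X), (p.2 : X)) ∈ S}, V.subset_mem hS ?_,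
      {p | ((p.1 : X), (p.2 : X)) ∈ S}, V.subset_mem hS ?_, rfl⟩, ?_⟩
    · rintro _ ⟨p, hp, rfl⟩
      exact hp
    · rintro _ ⟨p, hp, rfl⟩
      exact hp
    · rw [Set.image_union, Set.image_image, Set.image_image]
      apply Set.Subset.antisymm
      · intro p hpS
        rcases hp p hpS with ⟨h1, h2⟩ | ⟨h1, h2⟩
        · exact Or.inl ⟨(⟨p.1, h1⟩, ⟨p.2, h2⟩), hpS, rfl⟩
        · exact Or.inr ⟨(⟨p.1, h1⟩, ⟨p.2, h2⟩), hpS, rfl⟩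
      · rintro _ (⟨p, hp, rfl⟩ | ⟨p, hp, rfl⟩)
        · exact hp
        · exact hp

theorem adj_gluing {h : A ∪ B = Set.univ} {x y : X} : (V.gluing A B h).Adj x y ↔
    V.Adj x y ∧ ((x ∈ A ∧ y ∈ A) ∨ (x ∈ B ∧ y ∈ B)) := by
  simp [Adj, mem_gluing]

theorem adj_of_adj_gluing {h : A ∪ B = Set.univ} {x y : X} (hxy : (V.gluing A B h).Adj x y) :
    V.Adj x y := (adj_gluing.1 hxy).1

theorem exists_isShortPath_iff {x w y : X} :
    (∃ γ, IsShortPath V γ x w y) ↔ V.Adj x w ∧ V.Adj w y := by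
  constructor
  · rintro ⟨γ, hγ, rfl, rfl, rfl⟩
    exact ⟨hγ.adj (adj_sub.2 (adj_Z1.2 (by norm_num))), hγ.adj (adj_sub.2 (adj_Z1.2 (by norm_num)))⟩
  · rintro ⟨h1, h2⟩
    have hp : IsPath V (fun z => if z ≤ 0 then x else if z ≤ 1 then w else y) x y := by
      refine ⟨fun t => ?_, ⟨0, fun t ht => if_pos ht⟩,
        ⟨2, fun t ht => by rw [if_neg (by omega), if_neg (by omega)]⟩⟩
      split_ifs <;> first | exact Adj.refl _ _ | assumption | omega
    exact ⟨fun z => if (z : ℤ) ≤ 0 then x else if (z : ℤ) ≤ 1 then w else y,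
      hp.born.comp (bornologous_val _ _), by simp, by simp, by simp⟩

theorem pair_mem_controlled {x y y' : X} :
    {(x, y), (x, y')} ∈ V.controlled ↔ V.Adj x y ∧ V.Adj x y' :=
  ⟨fun h => ⟨adj_of_mem h (by simp), adj_of_mem h (by simp)⟩, fun h => V.union_mem h.1 h.2⟩

namespace WellSplit

variable (hs : V.WellSplit A B)

/-- The gluing of `A` and `B`. -/
abbrev glued : SemiCoarse X := V.gluing A B hs.cover

theorem exists_common {x y y' : X} (h : V.Adj x y) (h' : V.Adj x y')
    (hG : ¬ (hs.glued.Adj x y ∧ hs.glued.Adj x y'))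
    (hy : hs.glued.Adj y y') :
    ∃ w, hs.glued.Adj x w ∧ hs.glued.Adj w y ∧
      hs.glued.Adj w y' := by
  obtain ⟨γ, γ', w, h1, h2⟩ := hs.common_midpoint x y y'
    ⟨pair_mem_controlled.2 ⟨h, h'⟩, fun h => hG (pair_mem_controlled.1 h)⟩ hy
  have h1 := exists_isShortPath_iff.1 ⟨γ, h1⟩
  have h2 := exists_isShortPath_iff.1 ⟨γ', h2⟩
  exact ⟨w, h1.1, h1.2, h2.2⟩

/-- Condition (1) with `y' = y` gives the midpoint of an edge outside the gluing; an edge of the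
gluing has `x` itself as a midpoint. -/
theorem exists_mid {x y : X} (h : V.Adj x y) :
    ∃ w, hs.glued.Adj x w ∧ hs.glued.Adj w y := by
  by_cases hG : hs.glued.Adj x y
  · exact ⟨x, Adj.refl _ _, hG⟩
  · obtain ⟨w, h1, h2, -⟩ := hs.exists_common h h (fun h => hG h.1) (Adj.refl _ y)
    exact ⟨w, h1, h2⟩

/-- Condition (2) connects midpoints only in `V`. But `x` and `y` lie together neither in `A` nor in
`B`, so every midpoint lies in `A ∩ B`, and adjacent midpoints are adjacent in the gluing. -/
theorem mid_induction {x y w w' : X} (h : V.Adj x y) (hG : ¬ hs.glued.Adj x y)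
    {P : X → Prop}
    (hP : ∀ a b, hs.glued.Adj x a → hs.glued.Adj a y →
      hs.glued.Adj x b → hs.glued.Adj b y →
      hs.glued.Adj a b → P a → P b)
    (hw : hs.glued.Adj x w ∧ hs.glued.Adj w y)
    (hw' : hs.glued.Adj x w' ∧ hs.glued.Adj w' y)
    (h0 : P w) : P w' := by
  have hc := hs.midpoints_connected x y y
    ⟨pair_mem_controlled.2 ⟨h, h⟩, fun h => hG (pair_mem_controlled.1 h).1⟩ (Adj.refl _ y)
  refine hc.induction (P := fun z => P z) (x := ⟨w, exists_isShortPath_iff.2 hw⟩)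
    (y := ⟨w', exists_isShortPath_iff.2 hw'⟩) h0 ?_
  rintro ⟨a, ha⟩ ⟨b, hb⟩ hab
  have ha := exists_isShortPath_iff.1 ha
  have hb := exists_isShortPath_iff.1 hb
  refine hP a b ha.1 ha.2 hb.1 hb.2 ?_
  rw [adj_sub] at hab
  simp only [adj_gluing] at ha hb hG ⊢
  refine ⟨hab, ?_⟩
  by_contra hn
  tauto

/-! ### Gluing and extending cocycles. -/

variable {H : Type*} [Group H]

open Classical in
/-- A cocycle on the gluing, from two cocycles which agree on the intersection. -/
noncomputable def glueCocycle (eA : Cocycle (V.sub A) H) (eB : Cocycle (V.sub B) H)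
    (hAB : ∀ (x y : X) (hx : x ∈ A ∩ B) (hy : y ∈ A ∩ B), V.Adj x y →
      eA ⟨x, hx.1⟩ ⟨y, hy.1⟩ = eB ⟨x, hx.2⟩ ⟨y, hy.2⟩) :
    Cocycle hs.glued H where
  toFun x y := if h : x ∈ A ∧ y ∈ A then eA ⟨x, h.1⟩ ⟨y, h.2⟩ else
    if h : x ∈ B ∧ y ∈ B then eB ⟨x, h.1⟩ ⟨y, h.2⟩ else 1
  mul := by
    intro x y z h1 h2 h3
    have hB : ∀ {x y : X} (hx : x ∈ B) (hy : y ∈ B), V.Adj x y →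
        (if h : x ∈ A ∧ y ∈ A then eA ⟨x, h.1⟩ ⟨y, h.2⟩ else
          if h : x ∈ B ∧ y ∈ B then eB ⟨x, h.1⟩ ⟨y, h.2⟩ else 1) = eB ⟨x, hx⟩ ⟨y, hy⟩ := by
      intro x y hx hy h
      by_cases hA : x ∈ A ∧ y ∈ A
      · rw [dif_pos hA]
        exact hAB x y ⟨hA.1, hx⟩ ⟨hA.2, hy⟩ h
      · rw [dif_neg hA, dif_pos ⟨hx, hy⟩]
    rw [adj_gluing] at h1 h2 h3
    by_cases hA : x ∈ A ∧ y ∈ A ∧ z ∈ A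
    · obtain ⟨hx, hy, hz⟩ := hA
      rw [dif_pos ⟨hx, hy⟩, dif_pos ⟨hy, hz⟩, dif_pos ⟨hx, hz⟩]
      exact eA.mul (adj_sub.2 h1.1) (adj_sub.2 h2.1) (adj_sub.2 h3.1)
    -- A vertex outside `A` forces both sides through it into `B`, hence all three vertices.
    · obtain ⟨hx, hy, hz⟩ : x ∈ B ∧ y ∈ B ∧ z ∈ B := by tauto
      rw [hB hx hy h1.1, hB hy hz h2.1, hB hx hz h3.1]
      exact eB.mul (adj_sub.2 h1.1) (adj_sub.2 h2.1) (adj_sub.2 h3.1)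

open Classical in
/-- Every cocycle on the gluing extends to the whole space. -/
theorem exists_extension (e : Cocycle hs.glued H) :
    ∃ e' : Cocycle V H, ∀ x y, hs.glued.Adj x y → e' x y = e x y := by
  choose m hm using fun (x y : X) (h : V.Adj x y) => hs.exists_mid h
  set E : X → X → H := fun x y => if h : V.Adj x y then e x (m x y h) * e (m x y h) y else 1 with hE
  have hmid : ∀ {x y w}, V.Adj x y → hs.glued.Adj x w → hs.glued.Adj w y →
      E x y = e x w * e w y := by
    intro x y w h h1 h2
    have : E x y = e x (m x y h) * e (m x y h) y := dif_pos h
    rw [this]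
    by_cases hxy : hs.glued.Adj x y
    · rw [e.mul (hm x y h).1 (hm x y h).2 hxy, e.mul h1 h2 hxy]
    -- For adjacent midpoints `a` and `b`, both products equal `e x b * e b a * e a y`; so the value
    -- is the same for all midpoints.
    · refine hs.mid_induction h hxy (P := fun w => e x (m x y h) * e (m x y h) y = e x w * e w y)
        ?_ (hm x y h) ⟨h1, h2⟩ rfl
      intro a b ha ha' hb hb' hab h'
      rw [h', ← e.mul hb hab.symm ha, mul_assoc, e.mul hab.symm ha' hb']
  have hext : ∀ x y, hs.glued.Adj x y → E x y = e x y := fun x y h => by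
    rw [hmid (adj_of_adj_gluing h) (Adj.refl _ x) h, e.self, one_mul]
  refine ⟨⟨E, ?_⟩, hext⟩
  intro x y z h1 h2 h3
  by_cases hall : hs.glued.Adj x y ∧ hs.glued.Adj y z ∧ hs.glued.Adj x z
  · rw [hext x y hall.1, hext y z hall.2.1, hext x z hall.2.2]
    exact e.mul hall.1 hall.2.1 hall.2.2
  -- Two of the three vertices lie together in `A` or in `B`, so some side belongs to the gluing.
  -- Condition (1), applied at the opposite vertex, gives a point adjacent in the gluing to all
  -- three.
  · obtain ⟨w, hx, hy, hz⟩ : ∃ w, hs.glued.Adj x w ∧ hs.glued.Adj y w ∧ hs.glued.Adj z w := by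
      have hc : ∀ p : X, p ∈ A ∨ p ∈ B := fun p => (hs.cover ▸ Set.mem_univ p : p ∈ A ∪ B)
      have : hs.glued.Adj y z ∨ hs.glued.Adj x z ∨ hs.glued.Adj x y := by
        simp only [adj_gluing]
        have := hc x
        have := hc y
        have := hc z
        tauto
      rcases this with h | h | h
      · obtain ⟨w, hx, hy, hz⟩ := hs.exists_common h1 h3 (fun h' => hall ⟨h'.1, h, h'.2⟩) h
        exact ⟨w, hx, hy.symm, hz.symm⟩
      · obtain ⟨w, hy, hx, hz⟩ := hs.exists_common h1.symm h2
          (fun h' => hall ⟨h'.1.symm, h'.2, h⟩) h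
        exact ⟨w, hx.symm, hy, hz.symm⟩
      · obtain ⟨w, hz, hx, hy⟩ := hs.exists_common h3.symm h2.symm
          (fun h' => hall ⟨h, h'.2.symm, h'.1.symm⟩) h
        exact ⟨w, hx.symm, hy.symm, hz⟩
    -- With `w` as midpoint of all three sides, the inner factors `e w y` and `e y w` cancel.
    rw [hmid h1 hx hy.symm, hmid h2 hy hz.symm, hmid h3 hx hz.symm, mul_assoc, ← mul_assoc (e w y),
      e.mul hy.symm hy (Adj.refl _ w), e.self, one_mul]

end WellSplit

end WellSplit

/-! ### The pushout -/

section Pushout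

variable {X : Type u} {V : SemiCoarse X} {A B : Set X} {𝒰 : Set (Set X)}

/-- Every point lies in `A` or in `B`, and every edge is a composite of two edges each of which lies
in `A` or in `B`. -/
theorem relPi_hom_ext_of_wellSplit (h𝒰 : PointFamily 𝒰) (hs : V.WellSplit A B)
    {K : Type*} [Groupoid K] {F G : RelFundGroupoid V 𝒰 ⥤ K}
    (hA : mapFunctor (isRelEmbedding_val V 𝒰 A) ⋙ F = mapFunctor (isRelEmbedding_val V 𝒰 A) ⋙ G)
    (hB : mapFunctor (isRelEmbedding_val V 𝒰 B) ⋙ F = mapFunctor (isRelEmbedding_val V 𝒰 B) ⋙ G) :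
    F = G := by
  have hobj : ∀ x, F.obj (h𝒰.pt V x) = G.obj (h𝒰.pt V x) := by
    intro x
    rcases (hs.cover ▸ Set.mem_univ x : x ∈ A ∪ B) with hx | hx
    · exact Functor.congr_obj hA ((h𝒰.trace A).pt _ ⟨x, hx⟩)
    · exact Functor.congr_obj hB ((h𝒰.trace B).pt _ ⟨x, hx⟩)
  have sub : ∀ C : Set X,
      mapFunctor (isRelEmbedding_val V 𝒰 C) ⋙ F = mapFunctor (isRelEmbedding_val V 𝒰 C) ⋙ G →
      ∀ {x y : X}, x ∈ C → y ∈ C → ∀ (h : V.Adj x y) {c} (h1 : h𝒰.pt V x = c) (h2 : h𝒰.pt V y = c),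
        HEq (F.map (h𝒰.edgeHom h h1 h2)) (G.map (h𝒰.edgeHom h h1 h2)) := by
    rintro C hC x y hx hy h _ rfl h2
    have h' : (V.sub C).Adj ⟨x, hx⟩ ⟨y, hy⟩ := adj_sub.2 h
    have e := (h𝒰.trace C).mapFunctor_map_edgeHom h𝒰 (isRelEmbedding_val V 𝒰 C) h' rfl
      ((h𝒰.trace C).pt_eq_of_adj h').symm
    have key : HEq ((mapFunctor (isRelEmbedding_val V 𝒰 C) ⋙ F).map
        ((h𝒰.trace C).edgeHom h' rfl ((h𝒰.trace C).pt_eq_of_adj h').symm))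
        ((mapFunctor (isRelEmbedding_val V 𝒰 C) ⋙ G).map
        ((h𝒰.trace C).edgeHom h' rfl ((h𝒰.trace C).pt_eq_of_adj h').symm)) := by
      rw [hC]
    rw [Functor.comp_map, Functor.comp_map, e] at key
    exact key
  have glued : ∀ {x y : X} (h : hs.glued.Adj x y) {c} (h1 : h𝒰.pt V x = c)
      (h2 : h𝒰.pt V y = c), HEq (F.map (h𝒰.edgeHom (adj_of_adj_gluing h) h1 h2))
        (G.map (h𝒰.edgeHom (adj_of_adj_gluing h) h1 h2)) := by
    intro x y h c h1 h2
    rcases (adj_gluing.1 h).2 with ⟨hx, hy⟩ | ⟨hx, hy⟩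
    · exact sub A hA hx hy _ _ _
    · exact sub B hB hx hy _ _ _
  refine h𝒰.functor_ext hobj fun {x y} h => ?_
  obtain ⟨w, h1, h2⟩ := hs.exists_mid h
  have hw := (h𝒰.pt_eq_of_adj (adj_of_adj_gluing h1)).symm
  rw [← h𝒰.edgeHom_comp (adj_of_adj_gluing h1) (adj_of_adj_gluing h2) h rfl hw
    (h𝒰.pt_eq_of_adj h).symm, F.map_comp, G.map_comp]
  exact heq_comp (hobj x) (hobj x) (hobj x) (glued h1 _ _) (glued h2 _ _)

/-- For each component `c` of `X`, the functors `F` and `G` give cocycles on `A` and on `B` with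
values in one vertex group of `K`. These agree on `A ∩ B`, glue, and extend to `X`, where they
define the functor. -/
theorem exists_relPi_desc_of_wellSplit (h𝒰 : PointFamily 𝒰) (hs : V.WellSplit A B)
    {K : Type*} [Groupoid K] (F : RelFundGroupoid (V.sub A) (trace 𝒰 A) ⥤ K)
    (G : RelFundGroupoid (V.sub B) (trace 𝒰 B) ⥤ K)
    (hFG : mapFunctor (isRelEmbedding_inclusion V 𝒰 (Set.inter_subset_left : A ∩ B ⊆ A)) ⋙ F =
      mapFunctor (isRelEmbedding_inclusion V 𝒰 (Set.inter_subset_right : A ∩ B ⊆ B)) ⋙ G) :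
    ∃ D : RelFundGroupoid V 𝒰 ⥤ K, mapFunctor (isRelEmbedding_val V 𝒰 A) ⋙ D = F ∧
      mapFunctor (isRelEmbedding_val V 𝒰 B) ⋙ D = G := by
  classical
  have hA𝒰 := h𝒰.trace A
  have hB𝒰 := h𝒰.trace B
  have hc : ∀ p : X, p ∉ A → p ∈ B := fun p hp =>
    (hs.cover ▸ Set.mem_univ p : p ∈ A ∪ B).resolve_left hp
  obtain ⟨oX, oA, oB⟩ : ∃ oX : X → K, (∀ x (h : x ∈ A), F.obj (hA𝒰.pt _ ⟨x, h⟩) = oX x) ∧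
      ∀ x (h : x ∈ B), G.obj (hB𝒰.pt _ ⟨x, h⟩) = oX x := by
    refine ⟨fun x => if h : x ∈ A then F.obj (hA𝒰.pt _ ⟨x, h⟩) else
      G.obj (hB𝒰.pt _ ⟨x, hc x h⟩), fun x h => ?_, fun x hB => ?_⟩
    · beta_reduce
      rw [dif_pos h]
    beta_reduce
    by_cases hA : x ∈ A
    · rw [dif_pos hA]
      exact (Functor.congr_obj hFG ((h𝒰.trace (A ∩ B)).pt _ ⟨x, hA, hB⟩)).symm
    · rw [dif_neg hA]
  have oG : ∀ {x y : X}, hs.glued.Adj x y → oX x = oX y := by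
    intro x y h
    obtain ⟨h, ⟨hx, hy⟩ | ⟨hx, hy⟩⟩ := adj_gluing.1 h
    · rw [← oA x hx, ← oA y hy]
      exact congrArg F.obj (hA𝒰.pt_eq_of_adj (adj_sub.2 h))
    · rw [← oB x hx, ← oB y hy]
      exact congrArg G.obj (hB𝒰.pt_eq_of_adj (adj_sub.2 h))
  -- An edge of `X` need not lie in `A` or in `B`, but its two halves through a midpoint do.
  have oV : ∀ {x y : X}, h𝒰.pt V x = h𝒰.pt V y → oX x = oX y := fun {x y} h =>
    h𝒰.induction_of_pt_eq (P := fun z => oX x = oX z) (fun a b hab h => by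
      obtain ⟨w, h1, h2⟩ := hs.exists_mid hab
      exact h.trans ((oG h1).trans (oG h2))) h rfl
  obtain ⟨o, ho⟩ : ∃ o : RelFundGroupoid V 𝒰 → K, ∀ x, oX x = o (h𝒰.pt V x) := by
    choose s hs using h𝒰.exists_pt (V := V)
    exact ⟨fun c => oX (s c), fun x => oV (hs _).symm⟩
  have hFo : ∀ a, F.obj a = o ((mapFunctor (isRelEmbedding_val V 𝒰 A)).obj a) := fun a => by
    obtain ⟨⟨x, hx⟩, rfl⟩ := hA𝒰.exists_pt a
    exact (oA x hx).trans (ho x)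
  have hGo : ∀ a, G.obj a = o ((mapFunctor (isRelEmbedding_val V 𝒰 B)).obj a) := fun a => by
    obtain ⟨⟨x, hx⟩, rfl⟩ := hB𝒰.exists_pt a
    exact (oB x hx).trans (ho x)
  -- Several components of `A` may lie in one component `c` of `X`. All of them are sent to `o c`,
  -- so their edges together define one cocycle.
  have sF : ∀ c, ∀ a ∈ {a | (mapFunctor (isRelEmbedding_val V 𝒰 A)).obj a = c}, F.obj a = o c := by
    rintro _ a rfl
    exact hFo a
  have sG : ∀ c, ∀ a ∈ {a | (mapFunctor (isRelEmbedding_val V 𝒰 B)).obj a = c}, G.obj a = o c := by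
    rintro _ a rfl
    exact hGo a
  have hAB : ∀ c, ∀ (x y : X) (hx : x ∈ A ∩ B) (hy : y ∈ A ∩ B), V.Adj x y →
      hA𝒰.functorCocycle F (sF c) ⟨x, hx.1⟩ ⟨y, hy.1⟩ =
        hB𝒰.functorCocycle G (sG c) ⟨x, hx.2⟩ ⟨y, hy.2⟩ := by
    intro c x y hx hy h
    by_cases hxc : h𝒰.pt V x = c
    · apply eq_of_heq
      have h' : (V.sub (A ∩ B)).Adj ⟨x, hx⟩ ⟨y, hy⟩ := adj_sub.2 h
      have h0 := h𝒰.trace (A ∩ B)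
      have key : HEq ((mapFunctor (isRelEmbedding_inclusion V 𝒰 Set.inter_subset_left) ⋙ F).map
          (h0.edgeHom h' rfl (h0.pt_eq_of_adj h').symm))
          ((mapFunctor (isRelEmbedding_inclusion V 𝒰 Set.inter_subset_right) ⋙ G).map
          (h0.edgeHom h' rfl (h0.pt_eq_of_adj h').symm)) := by
        rw [hFG]
      rw [Functor.comp_map, Functor.comp_map, h0.mapFunctor_map_edgeHom hA𝒰,
        h0.mapFunctor_map_edgeHom hB𝒰] at key
      exact (hA𝒰.functorCocycle_heq F (sF c) (x := ⟨x, hx.1⟩) (y := ⟨y, hy.1⟩)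
        (adj_sub.2 h) hxc).trans
        (key.trans (hB𝒰.functorCocycle_heq G (sG c) (x := ⟨x, hx.2⟩) (y := ⟨y, hy.2⟩)
          (adj_sub.2 h) hxc).symm)
    -- Away from the component `c` both cocycles take the default value 1.
    · rw [hA𝒰.functorCocycle_eq_one F (sF c) (x := ⟨x, hx.1⟩) (fun h => hxc h),
        hB𝒰.functorCocycle_eq_one G (sG c) (x := ⟨x, hx.2⟩) (fun h => hxc h)]
  choose e he using fun c => hs.exists_extension (hs.glueCocycle _ _ (hAB c))
  refine ⟨h𝒰.functorOfCocycle o e, hA𝒰.functor_ext (fun x => (hFo _).symm) ?_,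
    hB𝒰.functor_ext (fun x => (hGo _).symm) ?_⟩
  · rintro ⟨x, hx⟩ ⟨y, hy⟩ h
    rw [Functor.comp_map, hA𝒰.mapFunctor_map_edgeHom h𝒰, h𝒰.functorOfCocycle_map_edgeHom,
      he _ _ _ (adj_gluing.2 ⟨adj_sub.1 h, Or.inl ⟨hx, hy⟩⟩)]
    refine HEq.trans (heq_of_eq (dif_pos ⟨hx, hy⟩)) ?_
    exact hA𝒰.functorCocycle_heq F (sF _) h rfl
  · rintro ⟨x, hx⟩ ⟨y, hy⟩ h
    rw [Functor.comp_map, hB𝒰.mapFunctor_map_edgeHom h𝒰, h𝒰.functorOfCocycle_map_edgeHom,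
      he _ _ _ (adj_gluing.2 ⟨adj_sub.1 h, Or.inr ⟨hx, hy⟩⟩)]
    refine HEq.trans (heq_of_eq ?_) (hB𝒰.functorCocycle_heq G (sG _) h rfl)
    -- The glued cocycle prefers the value from `A`, so for pairs in `A ∩ B` the agreement of the
    -- two cocycles is needed.
    by_cases hA : x ∈ A ∧ y ∈ A
    · exact (dif_pos hA).trans (hAB _ x y ⟨hA.1, hx⟩ ⟨hA.2, hy⟩ (adj_sub.1 h))
    · exact (dif_neg hA).trans (dif_pos ⟨hx, hy⟩)

theorem PointFamily.relPi_square (h𝒰 : PointFamily 𝒰) (V : SemiCoarse X) (A B : Set X) :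
    mapFunctor (isRelEmbedding_inclusion V 𝒰 (Set.inter_subset_left : A ∩ B ⊆ A)) ⋙
        mapFunctor (isRelEmbedding_val V 𝒰 A) =
      mapFunctor (isRelEmbedding_inclusion V 𝒰 (Set.inter_subset_right : A ∩ B ⊆ B)) ⋙
        mapFunctor (isRelEmbedding_val V 𝒰 B) := by
  refine (h𝒰.trace _).functor_ext (fun _ => rfl) fun h => ?_
  rw [Functor.comp_map, Functor.comp_map, (h𝒰.trace _).mapFunctor_map_edgeHom (h𝒰.trace _),
    (h𝒰.trace _).mapFunctor_map_edgeHom (h𝒰.trace _), (h𝒰.trace _).mapFunctor_map_edgeHom h𝒰,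
    (h𝒰.trace _).mapFunctor_map_edgeHom h𝒰]
  rfl

/-- The Seifert–van Kampen theorem for well-split covers. -/
theorem PointFamily.isPushout_relPi (h𝒰 : PointFamily 𝒰) (hs : V.WellSplit A B) :
    IsPushout
      (V.relPiIncl 𝒰 (Set.inter_subset_left : A ∩ B ⊆ A))
      (V.relPiIncl 𝒰 (Set.inter_subset_right : A ∩ B ⊆ B))
      (V.relPiVal 𝒰 A) (V.relPiVal 𝒰 B) := by
  have hsq : V.relPiIncl 𝒰 (Set.inter_subset_left : A ∩ B ⊆ A) ≫ V.relPiVal 𝒰 A =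
      V.relPiIncl 𝒰 (Set.inter_subset_right : A ∩ B ⊆ B) ≫ V.relPiVal 𝒰 B :=
    h𝒰.relPi_square V A B
  choose desc hl hr using fun s : Limits.PushoutCocone
      (V.relPiIncl 𝒰 (Set.inter_subset_left : A ∩ B ⊆ A))
      (V.relPiIncl 𝒰 (Set.inter_subset_right : A ∩ B ⊆ B)) =>
    exists_relPi_desc_of_wellSplit h𝒰 hs s.inl s.inr s.condition
  refine ⟨⟨hsq⟩, ⟨Limits.PushoutCocone.IsColimit.mk hsq desc hl hr fun s m h1 h2 => ?_⟩⟩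
  exact relPi_hom_ext_of_wellSplit h𝒰 hs (Eq.trans h1 (hl s).symm) (Eq.trans h2 (hr s).symm)

end Pushout

end SemiCoarse

theorem mainTheorem4 {X : Type*} (V : SemiCoarse X) :
    (∀ A B : Set X, V.WellSplit A B →
      IsPushout
        (V.relPiIncl (SemiCoarse.singletons X) (Set.inter_subset_left : A ∩ B ⊆ A))
        (V.relPiIncl (SemiCoarse.singletons X) (Set.inter_subset_right : A ∩ B ⊆ B))
        (V.relPiVal (SemiCoarse.singletons X) A)
        (V.relPiVal (SemiCoarse.singletons X) B)) ∧
    ∀ x : X, ∃ φ : V.FundGroup x → (V.basePoint x ⟶ V.basePoint x),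
      Function.Injective φ ∧ φ 1 = 𝟙 (V.basePoint x) ∧ (∀ a b, φ (a * b) = φ a ≫ φ b) ∧
        ∀ f : SemiCoarse.Loop V x, φ (SemiCoarse.FundGroup.mk f) = f.toHom :=
  ⟨fun _ _ hs => (SemiCoarse.pointFamily_singletons X).isPushout_relPi hs,
    V.exists_fundGroup_embedding⟩
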